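/- Proposition 3.1. Let $K$ be an oriented hyperbolic knot in $S^3$, let $\Psi:\mathbb H^3\to S^3\setminus K$ be the universal covering (a smooth orientation preserving covering map whose deck transformations are orientation preserving isometries, $S^3\setminus K$ having finite hyperbolic volume), let $p\neq q$ be points of $S^3\setminus K$, and let $\widetilde p\in\Psi^{-1}(p)$. Products of loops and paths are concatenations, read from left to right. Let $\rho:\pi_1(S^3\setminus K,p)\to\mathrm{Isom}_+\mathbb H^3$ be the holonomy representation: $\rho(g)$ is the deck transformation sending $\widetilde p$ to the end point of the lift of $g$ starting at $\widetilde p$. Let $\mathcal Q(K)\subset\pi_1(S^3\setminus K,p)$ be the set of positive meridians, a quandle under $x*y=y^{-1}xy$. For $x\in\mathcal Q(K)$ the isometry $\rho(x)$ is parabolic; $x_\infty\in\partial\overline{\mathbb H^3}$ denotes its fixed point at infinity. Let $\mathcal G(\mathcal Q(K))$ be the group with generators the elements of $\mathcal Q(K)$ and relations $y^{-1}xy=x*y$. It acts on the right on the set $Z$ of homotopy classes (rel end points) of paths from $p$ to $q$ by $r\cdot x=x^{-1}r$ for $x\in\mathcal Q(K)$. For $r\in Z$ let $\widetilde r$ be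 the lift of a representative of $r$ with $\widetilde r(0)=\widetilde p$. For $v_0,v_1,v_2,v_3\in\overline{\mathbb H^3}$ let $\mathrm{algvol}\{v_0,v_1,v_2,v_3\}$ be the algebraic volume of the geodesic simplex with these (possibly ideal) vertices, i.e. its hyperbolic volume with the sign of its orientation, and $0$ if it is degenerate. Define $$\begin{aligned}\mathrm{vol}(r,x,y)={}&\mathrm{algvol}\{\widetilde p,\widetilde r(1),x_\infty,y_\infty\}+\mathrm{algvol}\{\widetilde p,\widetilde{r\cdot x}(1),y_\infty,x_\infty\}\\&+\mathrm{algvol}\{\widetilde p,\widetilde{r\cdot xy}(1),(x*y)_\infty,y_\infty\}+\mathrm{algvol}\{\widetilde p,\widetilde{r\cdot y}(1),y_\infty,(x*y)_\infty\}.\end{aligned}$$ Then all the simplices occurring here have finite volume, so that $\mathrm{vol}$ is a map $Z\times\mathcal Q(K)\times\mathcal Q(K)\to\mathbb R$, and $\mathrm{vol}$ is an $\mathbb R$-valued quandle $2$-cocycle with respect to $\mathcal Q(K)$ and $Z$: for all $r\in Z$ and $x,y,z\in\mathcal Q(K)$, $$\mathrm{vol}(r,x,x)=0,$$ $$\mathrm{vol}(r,x,y)+\mathrm{vol}(r\cdot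 y,x*y,z)+\mathrm{vol}(r,y,z)=\mathrm{vol}(r\cdot x,y,z)+\mathrm{vol}(r,x,z)+\mathrm{vol}(r\cdot z,x*z,y*z).$$ -/

import Mathlib

open scoped ContDiff unitInterval

noncomputable section

namespace KnotVolume

/-! ### Quandle 2-cocycles

Mathlib writes the quandle operation on the left: the element `x ∗ y` (the result of `y` acting
on `x`) is `y ◃ x`. Accordingly Mathlib's `Rack.EnvelGroup Q`, with relations
`y ◃ x = y x y⁻¹`, is the opposite of the group `𝒢(Q)` presented by the generators `x ∈ Q` and the
relations `y⁻¹ x y = x ∗ y`, and a set with a right action of `𝒢(Q)` is the same thing as a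
set with a left action of `Rack.EnvelGroup Q`. -/

/-- The action `r · x` of a generator `x ∈ Q` on an element `r` of a set `Y` that is acted on
by the associated group of `Q`. -/
def rdot {Q Y : Type*} [Quandle Q] [MulAction (Rack.EnvelGroup Q) Y] (r : Y) (x : Q) : Y :=
  (Rack.toEnvelGroup Q x : Rack.EnvelGroup Q) • r

/-- `x ∗ y`, in terms of Mathlib's left operation. -/
def qstar {Q : Type*} [Quandle Q] (x y : Q) : Q := Shelf.act y x

/-- `θ : Y × Q × Q → A` is a quandle 2-cocycle with respect to `Q` and `Y`. -/
structure IsQuandleTwoCocycle {Q Y A : Type*} [Quandle Q] [MulAction (Rack.EnvelGroup Q) Y]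
    [AddCommGroup A] (θ : Y → Q → Q → A) : Prop where
  degenerate : ∀ (r : Y) (x : Q), θ r x x = 0
  cocycle : ∀ (r : Y) (x y z : Q),
    θ r x y + θ (rdot r y) (qstar x y) z + θ r y z =
      θ (rdot r x) y z + θ r x z + θ (rdot r z) (qstar x z) (qstar y z)

/-! ### Oriented knots in the 3-sphere and their positive meridians -/

/-- Euclidean 4-space. -/
abbrev E4 : Type := EuclideanSpace ℝ (Fin 4)

/-- Determinant of four vectors of `ℝ⁴`. The 3-sphere is oriented as the boundary of the unit
ball: a basis `a, b, c` of the tangent space at `u` is positive iff `0 < det4 u a b c`. -/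
def det4 (u a b c : E4) : ℝ := Matrix.det (Matrix.of fun i j => (![u, a, b, c] i) j)

/-- An oriented smooth knot in `S³`, given by a regular simple closed parametrization of period 1
(oriented in the direction of increasing parameter). -/
structure OrientedKnot where
  toFun : ℝ → E4
  smooth : ContDiff ℝ ∞ toFun
  mem_sphere : ∀ t, toFun t ∈ Metric.sphere (0 : E4) 1
  periodic : Function.Periodic toFun 1
  injOn : Set.InjOn toFun (Set.Ico 0 1)
  regular : ∀ t, deriv toFun t ≠ 0

namespace OrientedKnot

/-- The knot complement `S³ ∖ K`, as a subset of `ℝ⁴`. -/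
def complSet (K : OrientedKnot) : Set E4 := Metric.sphere (0 : E4) 1 \ Set.range K.toFun

/-- The knot complement `S³ ∖ K`, as a space. -/
abbrev Complement (K : OrientedKnot) : Type := K.complSet

/-- A smooth disk in `S³` that meets the knot only in the image of its centre, where it crosses
the knot transversally and positively (direction of the knot followed by the orientation of
the disk is the orientation of `S³`). -/
structure MeridianDisk (K : OrientedKnot) where
  toFun : ℂ → E4
  smooth : ContDiff ℝ ∞ toFun
  mem_sphere : ∀ z, ‖z‖ ≤ 1 → toFun z ∈ Metric.sphere (0 : E4) 1
  param : ℝ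
  center : toFun 0 = K.toFun param
  avoid : ∀ z, ‖z‖ ≤ 1 → z ≠ 0 → toFun z ∉ Set.range K.toFun
  positive : 0 < det4 (K.toFun param) (deriv K.toFun param)
    (fderiv ℝ toFun 0 1) (fderiv ℝ toFun 0 Complex.I)

variable {K : OrientedKnot}

namespace MeridianDisk

theorem mem_complSet (d : K.MeridianDisk) {z : ℂ} (hz : ‖z‖ = 1) : d.toFun z ∈ K.complSet :=
  ⟨d.mem_sphere z hz.le, d.avoid z hz.le (by rintro rfl; simp at hz)⟩

/-- The point of the boundary circle of the disk at which the boundary loop is based. -/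
def base (d : K.MeridianDisk) : K.Complement := ⟨d.toFun 1, d.mem_complSet (by simp)⟩

/-- The boundary circle `s ↦ d (exp (2πis))` of a meridian disk, as a loop in the complement. -/
def boundaryLoop (d : K.MeridianDisk) : Path d.base d.base where
  toFun s := ⟨d.toFun (Complex.exp ((2 * Real.pi * (s : ℝ) : ℝ) * Complex.I)),
    d.mem_complSet (Complex.norm_exp_ofReal_mul_I _)⟩
  continuous_toFun := by
    refine Continuous.subtype_mk (d.smooth.continuous.comp ?_) _
    fun_prop
  source' := by simp [base]
  target' := by simp [base]

end MeridianDisk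

/-- A positive meridian: the class of a loop that runs along a path `α` to a meridian disk, once
around its boundary, and back along `α`. -/
def IsPositiveMeridian (p : K.Complement) (g : FundamentalGroup K.Complement p) : Prop :=
  ∃ (d : K.MeridianDisk) (α : Path p d.base),
    g = FundamentalGroup.fromPath
      (Path.Homotopic.Quotient.mk ((α.trans d.boundaryLoop).trans α.symm))

/-- The set `𝒬(K)` of positive meridians in `π₁(S³ ∖ K, p)`. -/
def KnotQuandle (p : K.Complement) : Type :=
  {g : FundamentalGroup K.Complement p // IsPositiveMeridian p g}

/-- In Mathlib's fundamental group the product `g * h` is the concatenation `h` followed by `g`.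
Hence `g * m * g⁻¹` is the concatenation `g⁻¹`, `m`, `g`. -/
theorem IsPositiveMeridian.conj {p : K.Complement} {m : FundamentalGroup K.Complement p}
    (hm : IsPositiveMeridian p m) (g : FundamentalGroup K.Complement p) :
    IsPositiveMeridian p (g * m * g⁻¹) := by
  obtain ⟨d, α, rfl⟩ := hm
  obtain ⟨β, rfl⟩ := Path.Homotopic.Quotient.mk_surjective g
  refine ⟨d, β.symm.trans α, ?_⟩
  rw [FundamentalGroup.mul_def, FundamentalGroup.mul_def, FundamentalGroup.inv_def]
  simp only [Path.trans_symm, Path.symm_symm, Path.Homotopic.Quotient.mk_trans,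
    Path.Homotopic.Quotient.mk_symm, Path.Homotopic.Quotient.trans_assoc]

/-- The knot quandle: the operation is conjugation, `x ∗ y = y ◃ x` being the concatenation
`y⁻¹`, `x`, `y`. -/
instance (p : K.Complement) : Quandle (KnotQuandle p) where
  act y x := ⟨y.1 * x.1 * y.1⁻¹, x.2.conj y.1⟩
  self_distrib := by
    intro x y z
    apply Subtype.ext
    change x.1 * (y.1 * z.1 * y.1⁻¹) * x.1⁻¹ =
      (x.1 * y.1 * x.1⁻¹) * (x.1 * z.1 * x.1⁻¹) * (x.1 * y.1 * x.1⁻¹)⁻¹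
    group
  invAct y x := ⟨y.1⁻¹ * x.1 * y.1, by simpa using x.2.conj y.1⁻¹⟩
  left_inv := by
    intro x y
    apply Subtype.ext
    change x.1⁻¹ * (x.1 * y.1 * x.1⁻¹) * x.1 = y.1
    group
  right_inv := by
    intro x y
    apply Subtype.ext
    change x.1 * (x.1⁻¹ * y.1 * x.1) * x.1⁻¹ = y.1
    group
  fix := by
    intro x
    apply Subtype.ext
    change x.1 * x.1 * x.1⁻¹ = x.1
    group

/-- The set `Z` of homotopy classes (relative to the end points) of paths from `p` to `q`. -/
def PathClass (p q : K.Complement) : Type := Path.Homotopic.Quotient p q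

theorem loop_smul_smul {X : Type*} [TopologicalSpace X] {p q : X}
    (g h : Path.Homotopic.Quotient p p) (r : Path.Homotopic.Quotient p q) :
    (h.trans g).symm.trans r = g.symm.trans (h.symm.trans r) := by
  obtain ⟨g, rfl⟩ := Path.Homotopic.Quotient.mk_surjective g
  obtain ⟨h, rfl⟩ := Path.Homotopic.Quotient.mk_surjective h
  rw [← Path.Homotopic.Quotient.trans_assoc, ← Path.Homotopic.Quotient.mk_trans,
    ← Path.Homotopic.Quotient.mk_symm, Path.trans_symm]
  rfl

/-- Loops at `p` act on `Z`: `g` sends `r` to the concatenation of `g⁻¹` and `r`. (This is a right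
action for the concatenation product, hence a left action for Mathlib's product.) -/
instance (p q : K.Complement) : MulAction (FundamentalGroup K.Complement p) (PathClass p q) where
  smul g r := (FundamentalGroup.toPath g).symm.trans r
  one_smul _ := Path.Homotopic.Quotient.refl_trans _
  mul_smul g h r := loop_smul_smul g h r

/-- The inclusion of the knot quandle into the fundamental group. -/
def KnotQuandle.incl (p : K.Complement) :
    ShelfHom (KnotQuandle p) (Quandle.Conj (FundamentalGroup K.Complement p)) where
  toFun x := x.1
  map_act' := rfl

/-- The induced action on `Z` of the associated group of the knot quandle: `r · x` is the
concatenation of `x⁻¹` and `r`. -/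
instance (p q : K.Complement) : MulAction (Rack.EnvelGroup (KnotQuandle p)) (PathClass p q) :=
  MulAction.compHom _ (Rack.toEnvelGroup.map (KnotQuandle.incl p))

end OrientedKnot

/-! ### Hyperbolic 3-space -/

/-- Euclidean 3-space. -/
abbrev E3 : Type := EuclideanSpace ℝ (Fin 3)

/-- Hyperbolic 3-space in the projective (Klein) model: the open unit ball of `ℝ³`, the geodesics
being the straight segments. -/
abbrev H3 : Type := Metric.ball (0 : E3) 1

/-- The sphere at infinity. -/
abbrev SphereAtInfinity : Type := Metric.sphere (0 : E3) 1

/-- Density of the hyperbolic volume of the Klein model against Lebesgue measure. -/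
def volDensity (x : E3) : ℝ := ((1 - ‖x‖ ^ 2) ^ 2)⁻¹

/-- The geodesic tetrahedron spanned by four points of the closed ball. -/
def tetrahedron (v₀ v₁ v₂ v₃ : E3) : Set E3 := convexHull ℝ {v₀, v₁, v₂, v₃}

/-- The algebraic volume of the geodesic simplex with the (possibly ideal) vertices `v₀, v₁, v₂, v₃`
in this order: the hyperbolic volume with the sign of the orientation, and zero for a degenerate
simplex. -/
def algvol (v₀ v₁ v₂ v₃ : E3) : ℝ :=
  SignType.sign (Matrix.det (Matrix.of fun i j => (![v₁ - v₀, v₂ - v₀, v₃ - v₀] i) j)) *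
    ∫ x in tetrahedron v₀ v₁ v₂ v₃, volDensity x

/-- The Lorentz form `diag (-1, 1, 1, 1)`. -/
def lorentzForm : Matrix (Fin 4) (Fin 4) ℝ := Matrix.diagonal ![-1, 1, 1, 1]

/-- `SO⁺(3,1)`, the group of orientation preserving isometries of hyperbolic 3-space. -/
def IsomPlus : Set (Matrix (Fin 4) (Fin 4) ℝ) :=
  {A | A.transpose * lorentzForm * A = lorentzForm ∧ A.det = 1 ∧ 0 < A 0 0}

/-- The projective action of a Lorentz matrix on the closed unit ball of `ℝ³`, where the point `x`
is identified with the line spanned by `(1, x)`. -/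
def projAct (A : Matrix (Fin 4) (Fin 4) ℝ) (x : E3) : E3 :=
  let w : Fin 4 → ℝ := A.mulVec (Fin.cons 1 (fun i => x i))
  WithLp.toLp 2 fun i : Fin 3 => w i.succ / w 0

/-! ### Hyperbolic knots -/

/-- A universal covering `Ψ : ℍ³ → S³ ∖ K` exhibiting `K` as a hyperbolic knot: `Ψ` is a smooth
orientation preserving covering map whose deck transformations are orientation preserving
isometries (so that `S³ ∖ K` carries a complete hyperbolic metric), and `S³ ∖ K` has
finite volume. -/
structure HyperbolicCovering (K : OrientedKnot) where
  toFun : E3 → E4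
  mapsTo : Set.MapsTo toFun (Metric.ball 0 1) K.complSet
  smooth : ContDiffOn ℝ ∞ toFun (Metric.ball 0 1)
  orientation : ∀ b ∈ Metric.ball (0 : E3) 1,
    0 < det4 (toFun b) (fderiv ℝ toFun b (EuclideanSpace.single 0 1))
      (fderiv ℝ toFun b (EuclideanSpace.single 1 1)) (fderiv ℝ toFun b (EuclideanSpace.single 2 1))
  isCoveringMap : IsCoveringMap (mapsTo.restrict toFun (Metric.ball 0 1) K.complSet)
  deck : ∀ h : H3 ≃ₜ H3, (∀ b : H3, toFun (h b) = toFun b) →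
    ∃ A ∈ IsomPlus, ∀ b : H3, (h b : E3) = projAct A b
  finiteVolume : ∃ F ⊆ Metric.ball (0 : E3) 1, MeasurableSet F ∧ toFun '' F = K.complSet ∧
    ∫⁻ x in F, ENNReal.ofReal (volDensity x) < ⊤

namespace HyperbolicCovering

open OrientedKnot

variable {K : OrientedKnot} (Ψ : HyperbolicCovering K)

/-- The covering map `ℍ³ → S³ ∖ K`. -/
def proj : H3 → K.Complement := Ψ.mapsTo.restrict Ψ.toFun (Metric.ball 0 1) K.complSet

theorem isCoveringMap_proj : IsCoveringMap Ψ.proj := Ψ.isCoveringMap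

variable {p q : K.Complement} (pt : Ψ.proj ⁻¹' {p})

/-- The end point `r̃(1)` of the lift `r̃` with `r̃(0) = p̃` of a path from `p` in the class `r`. -/
def liftEnd (r : PathClass p q) : H3 := (Ψ.isCoveringMap_proj.monodromy r pt).1

/-- For every `g ∈ π₁(S³ ∖ K, p)` there is a deck transformation, given by an element of
`SO⁺(3,1)`, that sends `p̃` to the end point of the lift of `g` starting at `p̃`. -/
theorem exists_holonomy (g : FundamentalGroup K.Complement p) :
    ∃ A ∈ IsomPlus, (∃ h : H3 ≃ₜ H3, (∀ b, Ψ.proj (h b) = Ψ.proj b) ∧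
      h pt.1 = Ψ.liftEnd pt (FundamentalGroup.toPath g) ∧ ∀ b : H3, (h b : E3) = projAct A b) := by
  have hΨ := Ψ.isCoveringMap_proj
  have : ContractibleSpace H3 :=
    (convex_ball (0 : E3) 1).contractibleSpace ⟨0, by simp⟩
  have : LocallyPathConnectedSpace H3 := Metric.isOpen_ball.locallyPathConnectedSpace
  let π : C(H3, K.Complement) := ⟨Ψ.proj, hΨ.continuous⟩
  have hproj : Ψ.proj (Ψ.liftEnd pt (FundamentalGroup.toPath g)) = Ψ.proj pt.1 := by
    have h1 : Ψ.proj (Ψ.liftEnd pt (FundamentalGroup.toPath g)) = p :=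
      (hΨ.monodromy (FundamentalGroup.toPath g) pt).2
    exact h1.trans (Eq.symm pt.2)
  obtain ⟨F, ⟨hF0, hF⟩, -⟩ := hΨ.existsUnique_continuousMap_lifts π pt.1 _ hproj
  obtain ⟨G, ⟨hG0, hG⟩, -⟩ := hΨ.existsUnique_continuousMap_lifts π
    (Ψ.liftEnd pt (FundamentalGroup.toPath g)) pt.1 hproj.symm
  have hGF : G.comp F = ContinuousMap.id H3 := by
    obtain ⟨_, -, hu⟩ := hΨ.existsUnique_continuousMap_lifts π pt.1 pt.1 rfl
    rw [hu (G.comp F) ⟨by simp [hF0, hG0], ?_⟩, hu (ContinuousMap.id H3) ⟨rfl, rfl⟩]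
    funext b
    exact (congrFun hG (F b)).trans (congrFun hF b)
  have hFG : F.comp G = ContinuousMap.id H3 := by
    obtain ⟨_, -, hu⟩ := hΨ.existsUnique_continuousMap_lifts π
      (Ψ.liftEnd pt (FundamentalGroup.toPath g)) (Ψ.liftEnd pt (FundamentalGroup.toPath g)) rfl
    rw [hu (F.comp G) ⟨by simp [hF0, hG0], ?_⟩, hu (ContinuousMap.id H3) ⟨rfl, rfl⟩]
    funext b
    exact (congrFun hF (G b)).trans (congrFun hG b)
  let h : H3 ≃ₜ H3 :=
    { toFun := F
      invFun := G
      left_inv := fun b => congrArg (fun f : C(H3, H3) => f b) hGF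
      right_inv := fun b => congrArg (fun f : C(H3, H3) => f b) hFG
      continuous_toFun := F.continuous
      continuous_invFun := G.continuous }
  have hh : ∀ b, Ψ.proj (h b) = Ψ.proj b := fun b => congrFun hF b
  obtain ⟨A, hA, hA'⟩ := Ψ.deck h fun b => congrArg Subtype.val (hh b)
  exact ⟨A, hA, h, hh, hF0, hA'⟩

/-- The holonomy representation `ρ : π₁(S³ ∖ K, p) → Isom₊ ℍ³ = SO⁺(3,1)`: `ρ(g)` is the deck
transformation that sends `p̃` to the end point of the lift of `g` starting at `p̃`. -/
def holonomy (g : FundamentalGroup K.Complement p) : Matrix (Fin 4) (Fin 4) ℝ :=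
  (Ψ.exists_holonomy pt g).choose

open Classical in
/-- The map `x ↦ x_∞` that sends a positive meridian `x` to the fixed point of `ρ(x)` on the sphere
at infinity. Since the holonomy of every meridian of a hyperbolic knot is parabolic, there is
exactly one such map; the `else` branch only makes the definition total. -/
def idealPoint : KnotQuandle p → SphereAtInfinity :=
  if h : ∃ f : KnotQuandle p → SphereAtInfinity, ∀ (x : KnotQuandle p) (ξ : SphereAtInfinity),
      projAct (Ψ.holonomy pt x.1) ξ = (ξ : E3) ↔ ξ = f x
  then h.choose
  else fun _ => ⟨EuclideanSpace.single 0 1, by simp⟩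

/-- `vol(r, x, y)`: the algebraic volume of the chain of four geodesic simplices attached to
`(r, x, y)`. -/
def vol (r : PathClass p q) (x y : KnotQuandle p) : ℝ :=
  algvol pt.1 (Ψ.liftEnd pt r) (Ψ.idealPoint pt x) (Ψ.idealPoint pt y) +
  algvol pt.1 (Ψ.liftEnd pt (rdot r x)) (Ψ.idealPoint pt y) (Ψ.idealPoint pt x) +
  algvol pt.1 (Ψ.liftEnd pt (rdot (rdot r x) y))
    (Ψ.idealPoint pt (qstar x y)) (Ψ.idealPoint pt y) +
  algvol pt.1 (Ψ.liftEnd pt (rdot r y)) (Ψ.idealPoint pt y) (Ψ.idealPoint pt (qstar x y))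

end HyperbolicCovering

end KnotVolume

end

/-!
# The volume cocycle of a hyperbolic knot

The proof has a geometric and a formal part. The geometric part consists of three facts about the
algebraic volume of tetrahedra with vertices in the closed ball of the Klein model.

* *Finiteness* (`integrableOn_volDensity_tetrahedron`). For `x = ∑ tᵢ vᵢ` the variance formula
  bounds `1 - ‖x‖²` below by a multiple of `t_k ∑ⱼ tⱼ ‖vⱼ - v_k‖²`, hence by a multiple of
  `‖x - v_k‖` for any `k` with `1/4 ≤ t_k`. So the density is dominated by a sum of functions
  `C ‖x - v_k‖⁻²`, which are locally integrable in dimension three.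
* *Additivity* (`algvol_five_term`). In barycentric coordinates of a nondegenerate tetrahedron, the
  ray issuing from a generic point `x` away from a further point `w` leaves the positive orthant
  once more than it enters it if `x` is inside, and as often as it enters it otherwise
  (`indicator_orthant_eq_sum_crossings`); its crossings correspond to the tetrahedra that contain
  `x` in the cone from `w` over the boundary.
* *Invariance* (`algvol_projAct`). A matrix in `SO⁺(3,1)` acts by a projective map which preserves
  tetrahedra and orientation, and whose Jacobian determinant `w₀⁻⁴` compensates the change of
  `1 - ‖x‖²` by the factor `w₀⁻²`.

For the formal part, write `R` for the end point of the lift of `r`, and identify meridians with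
their holonomy and with their ideal points. By uniqueness of lifts, `r · x` corresponds to `x⁻¹ R`
and `x ∗ y` to the ideal point `y⁻¹ x`, where the relation `ρ(y) ρ(x ∗ y) = ρ(x) ρ(y)` between deck
transformations of the ball extends to the sphere by continuity. In the cocycle condition the
simplices then group by their second vertex, which is one of the eight points obtained from `R` by
applying a subset of the three meridians. The five-term relation turns each group into a simplex
with vertices the base point and three ideal points, which cancels, and a simplex that does not
involve the base point; the latter cancel in pairs by invariance.

The ideal points enter only through their defining property, that they are the unique fixed points
of the holonomy on the sphere (`HasIdealPoints`). That the parabolic isometries attached to meridians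
have this property is not proved here: if one of them failed to have it, `idealPoint` would be
constant by definition, all four simplices would be degenerate, and `vol` would vanish.
-/

namespace KnotVolume

open MeasureTheory Matrix
open scoped unitInterval

/-! ### Finite volume of tetrahedra in the closed ball -/

theorem tetrahedron_eq_convexHull_range (v : Fin 4 → E3) :
    tetrahedron (v 0) (v 1) (v 2) (v 3) = convexHull ℝ (Set.range v) := by
  rw [tetrahedron]
  congr 1
  ext x
  simp [Fin.exists_fin_succ, eq_comm]

theorem mem_tetrahedron_iff (v : Fin 4 → E3) (x : E3) :
    x ∈ tetrahedron (v 0) (v 1) (v 2) (v 3) ↔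
      ∃ w : Fin 4 → ℝ, (∀ i, 0 ≤ w i) ∧ ∑ i, w i = 1 ∧ ∑ i, w i • v i = x := by
  rw [tetrahedron_eq_convexHull_range]
  constructor
  · intro hx
    have hconv : Convex ℝ {y : E3 | ∃ w : Fin 4 → ℝ,
        (∀ i, 0 ≤ w i) ∧ ∑ i, w i = 1 ∧ ∑ i, w i • v i = y} := by
      rintro _ ⟨w, hw, hw1, rfl⟩ _ ⟨w', hw', hw1', rfl⟩ a b ha hb hab
      refine ⟨fun i => a * w i + b * w' i, fun i => ?_, ?_, ?_⟩
      · have := hw i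
        have := hw' i
        positivity
      · rw [Finset.sum_add_distrib, ← Finset.mul_sum, ← Finset.mul_sum, hw1, hw1']
        linarith
      · simp only [add_smul, mul_smul, Finset.sum_add_distrib, Finset.smul_sum]
    refine convexHull_min ?_ hconv hx
    rintro _ ⟨j, rfl⟩
    exact ⟨Pi.single j 1, fun i => by by_cases h : i = j <;> simp [h],
      by simp, by simp [Pi.single_apply]⟩
  · rintro ⟨w, hw, hw1, rfl⟩
    exact mem_convexHull_of_exists_fintype w v hw hw1 (fun i => ⟨i, rfl⟩) rfl

theorem tetrahedron_subset_closedBall {v : Fin 4 → E3} (hv : ∀ i, ‖v i‖ ≤ 1) :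
    tetrahedron (v 0) (v 1) (v 2) (v 3) ⊆ Metric.closedBall 0 1 := by
  rw [tetrahedron_eq_convexHull_range]
  refine convexHull_min ?_ (convex_closedBall 0 1)
  rintro _ ⟨i, rfl⟩
  simpa using hv i

theorem isCompact_tetrahedron (v₀ v₁ v₂ v₃ : E3) : IsCompact (tetrahedron v₀ v₁ v₂ v₃) :=
  Set.Finite.isCompact_convexHull (𝕜 := ℝ) (Set.toFinite _)

theorem measurable_volDensity : Measurable volDensity := by
  unfold volDensity
  fun_prop

/-- The variance of a convex combination bounds the distance to the unit sphere from below. -/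
theorem sum_mul_norm_sub_sq_le {v : Fin 4 → E3} (hv : ∀ i, ‖v i‖ ≤ 1) {t : Fin 4 → ℝ}
    (ht : ∀ i, 0 ≤ t i) (ht1 : ∑ i, t i = 1) (k : Fin 4) :
    t k * ∑ j, t j * ‖v j - v k‖ ^ 2 ≤ 2 * (1 - ‖∑ i, t i • v i‖ ^ 2) := by
  have hx : ‖∑ i, t i • v i‖ ^ 2 = ∑ i, ∑ j, t i * (t j * inner ℝ (v j) (v i)) := by
    rw [← real_inner_self_eq_norm_sq, inner_sum]
    refine Finset.sum_congr rfl fun i _ => ?_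
    rw [sum_inner]
    refine Finset.sum_congr rfl fun j _ => ?_
    rw [real_inner_smul_left, real_inner_smul_right]
    ring
  have hV : ∑ i, t i * ∑ j, t j * ‖v j - v i‖ ^ 2 =
      2 * ∑ i, t i * ‖v i‖ ^ 2 - 2 * ‖∑ i, t i • v i‖ ^ 2 := by
    have h1 : ∀ i, t i * ∑ j, t j * ‖v j - v i‖ ^ 2 =
        t i * (∑ j, t j * ‖v j‖ ^ 2) + t i * ‖v i‖ ^ 2 -
          2 * ∑ j, t i * (t j * inner ℝ (v j) (v i)) := by
      intro i
      have : ∀ j, t j * ‖v j - v i‖ ^ 2 =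
          t j * ‖v j‖ ^ 2 + t j * ‖v i‖ ^ 2 - 2 * (t j * inner ℝ (v j) (v i)) := by
        intro j
        rw [norm_sub_sq_real]
        ring
      simp only [this, Finset.sum_add_distrib, Finset.sum_sub_distrib, ← Finset.sum_mul, ht1,
        ← Finset.mul_sum]
      ring
    simp only [h1, Finset.sum_add_distrib, Finset.sum_sub_distrib, ← Finset.sum_mul, ht1]
    rw [hx, ← Finset.mul_sum]
    ring
  have hle : t k * ∑ j, t j * ‖v j - v k‖ ^ 2 ≤ ∑ i, t i * ∑ j, t j * ‖v j - v i‖ ^ 2 :=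
    Finset.single_le_sum (f := fun i => t i * ∑ j, t j * ‖v j - v i‖ ^ 2)
      (fun i _ => mul_nonneg (ht i)
        (Finset.sum_nonneg fun j _ => mul_nonneg (ht j) (by positivity))) (Finset.mem_univ k)
  have hone : ∑ i, t i * ‖v i‖ ^ 2 ≤ 1 := by
    rw [← ht1]
    refine Finset.sum_le_sum fun i _ => mul_le_of_le_one_right (ht i) ?_
    exact pow_le_one₀ (norm_nonneg _) (hv i)
  linarith

/-- In a tetrahedron with distinct vertices in the closed ball, the distance to the sphere decays
at most linearly towards the nearest vertex. -/
theorem exists_mul_norm_sub_le {v : Fin 4 → E3} (hv : ∀ i, ‖v i‖ ≤ 1)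
    (hinj : Function.Injective v) :
    ∃ c > 0, ∀ x ∈ tetrahedron (v 0) (v 1) (v 2) (v 3), ∃ k, c * ‖x - v k‖ ≤ 1 - ‖x‖ ^ 2 := by
  obtain ⟨m, hm, hmv⟩ : ∃ m > 0, ∀ i j, i ≠ j → m ≤ ‖v i - v j‖ := by
    have hfin : ((fun p : Fin 4 × Fin 4 => ‖v p.1 - v p.2‖) '' {p | p.1 ≠ p.2}).Finite :=
      Set.toFinite _
    have hne : ((fun p : Fin 4 × Fin 4 => ‖v p.1 - v p.2‖) '' {p | p.1 ≠ p.2}).Nonempty :=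
      ⟨_, (0, 1), by simp, rfl⟩
    obtain ⟨m, ⟨p, hp, rfl⟩, hmin⟩ := hfin.exists_minimal hne
    refine ⟨_, norm_pos_iff.2 (sub_ne_zero.2 fun h => hp (hinj h)), fun i j hij => ?_⟩
    rcases le_total (‖v i - v j‖) (‖v p.1 - v p.2‖) with h | h
    · exact hmin ⟨(i, j), hij, rfl⟩ h
    · exact h
  refine ⟨m / 8, by positivity, fun x hx => ?_⟩
  obtain ⟨t, ht, ht1, rfl⟩ := (mem_tetrahedron_iff v x).1 hx
  obtain ⟨k, hk⟩ : ∃ k, 1 / 4 ≤ t k := by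
    by_contra! h
    have := h 0
    have := h 1
    have := h 2
    have := h 3
    rw [Fin.sum_univ_four] at ht1
    linarith
  refine ⟨k, ?_⟩
  have h1 := sum_mul_norm_sub_sq_le hv ht ht1 k
  have h2 : ‖∑ i, t i • v i - v k‖ ≤ ∑ j, t j * ‖v j - v k‖ := by
    have : ∑ i, t i • v i - v k = ∑ j, t j • (v j - v k) := by
      simp only [smul_sub, Finset.sum_sub_distrib, ← Finset.sum_smul, ht1, one_smul]
    rw [this]
    refine (norm_sum_le _ _).trans (Finset.sum_le_sum fun j _ => ?_)
    rw [norm_smul, Real.norm_of_nonneg (ht j)]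
  have h3 : m * ∑ j, t j * ‖v j - v k‖ ≤ ∑ j, t j * ‖v j - v k‖ ^ 2 := by
    rw [Finset.mul_sum]
    refine Finset.sum_le_sum fun j _ => ?_
    by_cases hjk : j = k
    · simp [hjk]
    · have := mul_le_mul_of_nonneg_left (hmv j k hjk)
        (mul_nonneg (ht j) (norm_nonneg (v j - v k)))
      nlinarith
  have h4 : 0 ≤ ∑ j, t j * ‖v j - v k‖ ^ 2 :=
    Finset.sum_nonneg fun j _ => mul_nonneg (ht j) (by positivity)
  nlinarith [mul_le_mul_of_nonneg_left h2 hm.le]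

theorem volume_tetrahedron_eq_zero {v : Fin 4 → E3} (hv : ¬ AffineIndependent ℝ v) :
    volume (tetrahedron (v 0) (v 1) (v 2) (v 3)) = 0 := by
  have hspan : affineSpan ℝ (Set.range v) ≠ ⊤ := by
    intro htop
    refine hv ((affineIndependent_iff_le_finrank_vectorSpan ℝ v (n := 3) (by simp)).2 ?_)
    rw [AffineSubspace.vectorSpan_eq_top_of_affineSpan_eq_top ℝ E3 E3 htop, finrank_top]
    simp
  refine measure_mono_null ?_ (Measure.addHaar_affineSubspace volume _ hspan)
  rw [tetrahedron_eq_convexHull_range]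
  exact convexHull_subset_affineSpan _

theorem integrableOn_volDensity_tetrahedron {v : Fin 4 → E3} (hv : ∀ i, ‖v i‖ ≤ 1) :
    IntegrableOn volDensity (tetrahedron (v 0) (v 1) (v 2) (v 3)) := by
  by_cases hinj : Function.Injective v
  swap
  · have h0 := volume_tetrahedron_eq_zero (v := v) fun h => hinj h.injective
    rw [IntegrableOn, Measure.restrict_eq_zero.2 h0]
    exact integrable_zero_measure
  obtain ⟨c, hc, hcx⟩ := exists_mul_norm_sub_le hv hinj
  have hK := isCompact_tetrahedron (v 0) (v 1) (v 2) (v 3)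
  have hloc : LocallyIntegrable (fun x : E3 => ‖x‖ ^ (-2 : ℝ)) volume :=
    locallyIntegrable_of_norm_le_rpow (C := 1) (α := 2) (by simp) (by simp; norm_num)
      (ae_of_all _ fun x => by simp)
      (by measurability)
  have hint : ∀ k, IntegrableOn (fun x : E3 => ‖x - v k‖ ^ (-2 : ℝ))
      (tetrahedron (v 0) (v 1) (v 2) (v 3)) := by
    intro k
    have hK' := hK.image (continuous_sub_right (v k))
    have := hloc.integrableOn_isCompact hK'
    rwa [(measurePreserving_sub_right volume (v k)).integrableOn_image
      (MeasurableEquiv.subRight (v k)).measurableEmbedding] at this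
  refine Integrable.mono' ((integrable_finsetSum Finset.univ fun k _ => hint k).const_mul
    ((c ^ 2)⁻¹)) measurable_volDensity.aestronglyMeasurable ?_
  have hne : ∀ᵐ x : E3, x ∉ Set.range v :=
    measure_eq_zero_iff_ae_notMem.1 ((Set.finite_range v).measure_zero volume)
  -- at an interior vertex the dominating function has the junk value `0⁻¹ = 0`
  filter_upwards [ae_restrict_mem hK.measurableSet, ae_restrict_of_ae hne] with x hx hxv
  obtain ⟨k, hk⟩ := hcx x hx
  have hpos : 0 < ‖x - v k‖ := norm_pos_iff.2 (sub_ne_zero.2 fun h => hxv ⟨k, h.symm⟩)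
  have h1 : ‖x - v k‖ ^ (-2 : ℝ) ≤ ∑ j, ‖x - v j‖ ^ (-2 : ℝ) :=
    Finset.single_le_sum (f := fun j => ‖x - v j‖ ^ (-2 : ℝ)) (fun j _ => by positivity)
      (Finset.mem_univ k)
  have h2 : volDensity x ≤ (c ^ 2)⁻¹ * ‖x - v k‖ ^ (-2 : ℝ) := by
    rw [Real.rpow_neg hpos.le, Real.rpow_two, ← mul_inv, ← mul_pow, volDensity]
    exact inv_anti₀ (by positivity) (pow_le_pow_left₀ (by positivity) hk 2)
  rw [Real.norm_of_nonneg (by unfold volDensity; positivity)]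
  exact h2.trans (mul_le_mul_of_nonneg_left h1 (by positivity))

/-! ### Orientation and signed indicators -/

/-- Homogeneous coordinates `(1, x)` of a point of `ℝ³`. -/
noncomputable def homog (x : E3) : Fin 4 → ℝ := Fin.cons 1 fun i => x i

/-- The determinant of the homogeneous coordinates of four points: six times the signed Euclidean
volume of the tetrahedron. -/
noncomputable def orient (v : Fin 4 → E3) : ℝ := Matrix.det (Matrix.of fun i => homog (v i))

theorem homog_apply (x : E3) :
    homog x 0 = 1 ∧ homog x 1 = x 0 ∧ homog x 2 = x 1 ∧ homog x 3 = x 2 :=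
  ⟨rfl, rfl, rfl, rfl⟩

theorem orient_eq_det_sub (v : Fin 4 → E3) :
    orient v = Matrix.det (Matrix.of fun i j => (![v 1 - v 0, v 2 - v 0, v 3 - v 0] i) j) := by
  rw [orient, Matrix.det_succ_row_zero]
  simp [Fin.sum_univ_succ, Matrix.det_fin_three, homog_apply, Fin.succAbove]
  ring

/-- The algebraic volume of a tetrahedron as a function of the family of its vertices. -/
noncomputable def algvolFamily (v : Fin 4 → E3) : ℝ := algvol (v 0) (v 1) (v 2) (v 3)

theorem algvolFamily_eq (v : Fin 4 → E3) :
    algvolFamily v =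
      SignType.sign (orient v) * ∫ x in convexHull ℝ (Set.range v), volDensity x := by
  rw [algvolFamily, algvol, orient_eq_det_sub, tetrahedron_eq_convexHull_range]

theorem algvolFamily_eq_zero {v : Fin 4 → E3} (hv : orient v = 0) : algvolFamily v = 0 := by
  simp [algvolFamily_eq, hv]

theorem orient_comp_swap (v : Fin 4 → E3) {i j : Fin 4} (hij : i ≠ j) :
    orient (v ∘ Equiv.swap i j) = -orient v := by
  have := Matrix.det_permute (Equiv.swap i j) (Matrix.of fun i => homog (v i))
  rw [Equiv.Perm.sign_swap hij] at this
  simp only [Units.val_neg, Units.val_one, Int.cast_neg, Int.cast_one, neg_one_mul] at this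
  exact this

theorem algvolFamily_comp_swap (v : Fin 4 → E3) {i j : Fin 4} (hij : i ≠ j) :
    algvolFamily (v ∘ Equiv.swap i j) = -algvolFamily v := by
  rw [algvolFamily_eq, algvolFamily_eq, orient_comp_swap v hij,
    (Equiv.swap i j).surjective.range_comp, Left.sign_neg]
  simp

theorem affineIndependent_of_orient_ne_zero {v : Fin 4 → E3} (hv : orient v ≠ 0) :
    AffineIndependent ℝ v := by
  have hlin : LinearIndependent ℝ fun i => homog (v i) :=
    Matrix.linearIndependent_rows_of_det_ne_zero hv
  rw [affineIndependent_iff_of_fintype]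
  intro w hw hwv
  rw [Finset.weightedVSub_eq_linear_combination (Finset.univ) hw] at hwv
  refine Fintype.linearIndependent_iff.1 hlin w ?_
  ext j
  refine Fin.cases ?_ (fun j => ?_) j
  · simpa [homog] using hw
  · have := congrArg (fun y : E3 => y j) hwv
    simpa [homog] using this

theorem affineSpan_eq_top_of_orient_ne_zero {v : Fin 4 → E3} (hv : orient v ≠ 0) :
    affineSpan ℝ (Set.range v) = ⊤ :=
  (affineIndependent_of_orient_ne_zero hv).affineSpan_eq_top_iff_card_eq_finrank_add_one.2
    (by simp)

theorem homog_sum {ι : Type*} (s : Finset ι) (c : ι → ℝ) (v : ι → E3) (hc : ∑ i ∈ s, c i = 1) :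
    homog (∑ i ∈ s, c i • v i) = ∑ i ∈ s, c i • homog (v i) := by
  ext j
  refine Fin.cases ?_ (fun j => ?_) j
  · simp [homog, hc]
  · simp [homog]

/-- Cramer's rule for barycentric coordinates. -/
theorem orient_update (b : AffineBasis (Fin 4) ℝ E3) (w : E3) (i : Fin 4) :
    orient (Function.update b i w) = b.coord i w * orient b := by
  have h := Matrix.det_updateRow_sum (Matrix.of fun i => homog (b i)) i fun k => b.coord k w
  rw [← smul_eq_mul, orient, orient, ← h]
  congr 1
  ext k : 1
  rw [Matrix.updateRow_apply]
  by_cases hk : k = i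
  · subst hk
    have := homog_sum Finset.univ (fun k => b.coord k w) b (b.sum_coord_apply_eq_one w)
    rw [b.linear_combination_coord_eq_self] at this
    simp [this]
  · simp [hk]

theorem affineMap_sum {ι : Type*} [Fintype ι] (f : E3 →ᵃ[ℝ] ℝ) (s : ι → ℝ) (u : ι → E3)
    (hs : ∑ i, s i = 1) : f (∑ i, s i • u i) = ∑ i, s i * f (u i) := by
  have hf : ∀ y, f y = f.linear y + f 0 := fun y => congrFun f.decomp y
  rw [hf, map_sum]
  simp only [hf (u _), mul_add, Finset.sum_add_distrib, ← Finset.sum_mul, hs, map_smul,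
    smul_eq_mul, one_mul]

/-- Barycentric description of the tetrahedron in which the vertex `b i` is replaced by `w`: the
line through `w` and `x` meets the face opposite to `b i` in a point of that face, and `x` lies
between `w` and that point. -/
theorem mem_convexHull_update_iff (b : AffineBasis (Fin 4) ℝ E3) (w x : E3) {i : Fin 4}
    (hi : b.coord i w ≠ 0) :
    x ∈ convexHull ℝ (Set.range (Function.update b i w)) ↔
      0 ≤ b.coord i x / b.coord i w ∧
        ∀ j, j ≠ i → 0 ≤ b.coord j x - b.coord i x / b.coord i w * b.coord j w := by
  rw [← tetrahedron_eq_convexHull_range, mem_tetrahedron_iff]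
  constructor
  · rintro ⟨s, hs, hs1, rfl⟩
    have hc : ∀ k, b.coord k (∑ j, s j • Function.update b i w j) =
        (if k = i then 0 else s k) + s i * b.coord k w := by
      intro k
      rw [affineMap_sum _ _ _ hs1, ← Finset.add_sum_erase _ _ (Finset.mem_univ i), add_comm]
      congr 1
      · rw [Finset.sum_congr rfl (g := fun j => if j = k then s j else 0)]
        · by_cases hk : k = i <;> simp [hk]
        · intro j hj
          rw [Function.update_of_ne (Finset.ne_of_mem_erase hj), b.coord_apply]
          by_cases hk : k = j <;> simp [hk, eq_comm]
      · simp
    have hi' : b.coord i (∑ j, s j • Function.update b i w j) / b.coord i w = s i := by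
      rw [hc]
      simp [hi]
    rw [hi']
    refine ⟨hs i, fun j hj => ?_⟩
    rw [hc, if_neg hj]
    simpa using hs j
  · rintro ⟨h0, h⟩
    set l := b.coord i x / b.coord i w with hl
    have hli : b.coord i x - l * b.coord i w = 0 := by
      rw [hl]
      field_simp
      ring
    refine ⟨Function.update (fun j => b.coord j x - l * b.coord j w) i l, fun j => ?_, ?_, ?_⟩
    · by_cases hj : j = i
      · subst hj
        simpa using h0
      · simpa [hj] using h j hj
    · rw [Finset.sum_update_of_mem (Finset.mem_univ i), ← Finset.erase_eq,
        Finset.sum_erase (f := fun j => b.coord j x - l * b.coord j w) _ hli, Finset.sum_sub_distrib, ← Finset.mul_sum,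
        b.sum_coord_apply_eq_one, b.sum_coord_apply_eq_one]
      ring
    · have : ∀ j, Function.update (fun j => b.coord j x - l * b.coord j w) i l j •
          Function.update b i w j =
          Function.update (fun j => (b.coord j x - l * b.coord j w) • b j) i (l • w) j := by
        intro j
        by_cases hj : j = i
        · subst hj
          simp
        · simp [hj]
      simp only [this]
      rw [Finset.sum_update_of_mem (Finset.mem_univ i), ← Finset.erase_eq,
        Finset.sum_erase _ (by rw [hli, zero_smul])]
      simp only [sub_smul, mul_smul, Finset.sum_sub_distrib, ← Finset.smul_sum,
        b.linear_combination_coord_eq_self]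
      abel

open Classical in
/-- Counting the crossings of the ray `t - λ c`, `λ ≥ 0`, with the boundary of the positive
orthant: since the ray leaves the orthant eventually, its starting point is inside iff the number
of exits minus the number of entries is one, and otherwise that difference is zero. A crossing of
the `i`-th wall happens at `λ = t i / c i`; it is an exit if `0 < c i` and an entry if `c i < 0`. -/
theorem indicator_orthant_eq_sum_crossings {ι : Type*} [Fintype ι] (c t : ι → ℝ)
    (hc : ∃ i, 0 < c i) (ht : ∀ i, t i ≠ 0)
    (hgen : ∀ i j, i ≠ j → c i ≠ 0 → c i * t j - c j * t i ≠ 0) :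
    (if ∀ i, 0 ≤ t i then 1 else 0 : ℝ) =
      ∑ i, (SignType.sign (c i) : ℝ) *
        (if 0 ≤ t i / c i ∧ ∀ j, j ≠ i → 0 ≤ t j - t i / c i * c j then 1 else 0) := by
  by_cases hbad : ∃ j, c j = 0 ∧ t j < 0
  · obtain ⟨j, hcj, htj⟩ := hbad
    rw [if_neg fun h => (h j).not_gt htj, Finset.sum_eq_zero]
    intro i _
    by_cases hij : j = i
    · subst hij
      simp [hcj]
    · rw [if_neg, mul_zero]
      intro h
      have := h.2 j hij
      rw [hcj] at this
      linarith
  push Not at hbad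
  set l : ι → ℝ := fun i => t i / c i with hl
  have hlt : ∀ i, c i ≠ 0 → t i = l i * c i := fun i hi => by
    rw [hl]
    field_simp
  have hl0 : ∀ i, c i ≠ 0 → l i ≠ 0 := fun i hi => div_ne_zero (ht i) hi
  have hne : ∀ i j, i ≠ j → c i ≠ 0 → c j ≠ 0 → l i ≠ l j := by
    intro i j hij hi hj h
    apply hgen i j hij hi
    rw [hlt i hi, hlt j hj, h]
    ring
  -- the walls with positive, negative and vanishing slope bound `λ` above, below and not at all
  have hwall : ∀ m j, 0 ≤ t j - m * c j ↔ (0 < c j → m ≤ l j) ∧ (c j < 0 → l j ≤ m) := by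
    intro m j
    rcases lt_trichotomy (c j) 0 with h | h | h
    · rw [hlt j h.ne]
      have : l j * c j - m * c j = (l j - m) * c j := by ring
      rw [this]
      constructor
      · intro h'
        refine ⟨fun h'' => absurd h'' h.not_gt, fun _ => ?_⟩
        by_contra! hlt
        nlinarith [mul_pos_of_neg_of_neg (neg_lt_zero.2 (sub_pos.2 hlt)) h]
      · rintro ⟨-, h'⟩
        exact mul_nonneg_of_nonpos_of_nonpos (sub_nonpos.2 (h' h)) h.le
    · simp [h, hbad j h]
    · rw [hlt j h.ne']
      have : l j * c j - m * c j = (l j - m) * c j := by ring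
      rw [this, mul_nonneg_iff_of_pos_right h]
      exact ⟨fun h' => ⟨fun _ => by linarith, fun h'' => absurd h'' h.not_gt⟩,
        fun h' => by linarith [h'.1 h]⟩
  have hin : (∀ i, 0 ≤ t i) ↔ ∀ j, (0 < c j → 0 ≤ l j) ∧ (c j < 0 → l j ≤ 0) :=
    forall_congr' fun j => by simpa using hwall 0 j
  have hcross : ∀ i, c i ≠ 0 → ((0 ≤ t i / c i ∧ ∀ j, j ≠ i → 0 ≤ t j - t i / c i * c j) ↔
      0 ≤ l i ∧ ∀ j, (0 < c j → l i ≤ l j) ∧ (c j < 0 → l j ≤ l i)) := by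
    intro i hi
    refine and_congr Iff.rfl ⟨fun h j => ?_, fun h j _ => (hwall _ j).2 (h j)⟩
    by_cases hj : j = i
    · subst hj
      exact ⟨fun _ => le_rfl, fun _ => le_rfl⟩
    · exact (hwall _ j).1 (h j hj)
  obtain ⟨p, hp, hpmin⟩ := (Finset.univ.filter fun i => 0 < c i).exists_min_image l
    (by simpa [Finset.filter_nonempty_iff] using hc)
  simp only [Finset.mem_filter, Finset.mem_univ, true_and] at hp hpmin
  have hother : ∀ i, 0 < c i → i ≠ p →
      ¬(0 ≤ t i / c i ∧ ∀ j, j ≠ i → 0 ≤ t j - t i / c i * c j) := by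
    intro i hi hip h
    rw [hcross i hi.ne'] at h
    exact hne i p hip hi.ne' hp.ne' (le_antisymm ((h.2 p).1 hp) (hpmin i hi))
  by_cases hneg : ∃ i, c i < 0
  · obtain ⟨n, hn, hnmax⟩ := (Finset.univ.filter fun i => c i < 0).exists_max_image l
      (by simpa [Finset.filter_nonempty_iff] using hneg)
    simp only [Finset.mem_filter, Finset.mem_univ, true_and] at hn hnmax
    have hpn : p ≠ n := fun h => by
      rw [h] at hp
      exact hp.not_gt hn
    rw [Finset.sum_eq_add p n hpn]
    · have h1 : (∀ i, 0 ≤ t i) ↔ 0 ≤ l p ∧ l n ≤ 0 := by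
        rw [hin]
        exact ⟨fun h => ⟨(h p).1 hp, (h n).2 hn⟩, fun h j =>
          ⟨fun hj => h.1.trans (hpmin j hj), fun hj => (hnmax j hj).trans h.2⟩⟩
      have h2 : (0 ≤ l p ∧ ∀ j, (0 < c j → l p ≤ l j) ∧ (c j < 0 → l j ≤ l p)) ↔
          0 ≤ l p ∧ l n ≤ l p :=
        and_congr Iff.rfl ⟨fun h => (h n).2 hn, fun h j =>
          ⟨hpmin j, fun hj => (hnmax j hj).trans h⟩⟩
      have h3 : (0 ≤ l n ∧ ∀ j, (0 < c j → l n ≤ l j) ∧ (c j < 0 → l j ≤ l n)) ↔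
          0 ≤ l n ∧ l n ≤ l p :=
        and_congr Iff.rfl ⟨fun h => (h p).1 hp, fun h j =>
          ⟨fun hj => h.trans (hpmin j hj), hnmax j⟩⟩
      simp only [hcross p hp.ne', hcross n hn.ne, h1, h2, h3, sign_pos hp, sign_neg hn]
      have := hl0 n hn.ne
      rcases lt_or_gt_of_ne this with h | h
      · have h' : ¬ 0 ≤ l n := h.not_ge
        by_cases h4 : 0 ≤ l p
        · simp [h4, h.le, h', h.le.trans h4]
        · simp [h4, h']
      · by_cases h4 : l n ≤ l p
        · simp [h.not_ge, h.le, h4, h.le.trans h4]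
        · simp [h.not_ge, h4]
    · intro i _ hi
      rcases lt_trichotomy (c i) 0 with h | h | h
      · rw [if_neg, mul_zero]
        intro h'
        rw [hcross i h.ne] at h'
        exact hne i n hi.2 h.ne hn.ne (le_antisymm (hnmax i h) ((h'.2 n).2 hn))
      · simp [h]
      · rw [if_neg (hother i h hi.1), mul_zero]
    · simp
    · simp
  · push Not at hneg
    rw [Finset.sum_eq_single p]
    · have h1 : (∀ i, 0 ≤ t i) ↔ 0 ≤ l p := by
        rw [hin]
        exact ⟨fun h => (h p).1 hp, fun h j =>
          ⟨fun hj => h.trans (hpmin j hj), fun hj => absurd hj (hneg j).not_gt⟩⟩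
      have h2 : (0 ≤ l p ∧ ∀ j, (0 < c j → l p ≤ l j) ∧ (c j < 0 → l j ≤ l p)) ↔ 0 ≤ l p :=
        and_iff_left fun j => ⟨hpmin j, fun hj => absurd hj (hneg j).not_gt⟩
      simp only [hcross p hp.ne', h1, h2, sign_pos hp]
      simp
    · intro i _ hi
      rcases (hneg i).eq_or_lt with h | h
      · simp [← h]
      · rw [if_neg (hother i h hi), mul_zero]
    · simp

theorem ae_affineMap_ne_zero (f : E3 →ᵃ[ℝ] ℝ) {p : E3} (hp : f p ≠ 0) : ∀ᵐ x, f x ≠ 0 := by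
  have h := Measure.addHaar_affineSubspace (volume : Measure E3)
    ((affineSpan ℝ {(0 : ℝ)}).comap f) ?_
  · rw [measure_eq_zero_iff_ae_notMem] at h
    filter_upwards [h] with x hx hx0
    exact hx (by simp [hx0])
  · intro htop
    have : p ∈ (affineSpan ℝ {(0 : ℝ)}).comap f := htop ▸ AffineSubspace.mem_top ℝ E3 p
    exact hp (by simpa using this)

open Classical in
/-- The indicator of a tetrahedron is almost everywhere the signed sum of the indicators of the
cones from `w` over its faces. -/
theorem ae_indicator_tetrahedron_eq (b : AffineBasis (Fin 4) ℝ E3) (w : E3) :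
    ∀ᵐ x : E3, (if x ∈ convexHull ℝ (Set.range b) then 1 else 0 : ℝ) =
      ∑ i, (SignType.sign (b.coord i w) : ℝ) *
        (if x ∈ convexHull ℝ (Set.range (Function.update b i w)) then 1 else 0) := by
  have h1 : ∀ i, ∀ᵐ x, b.coord i x ≠ 0 := fun i =>
    ae_affineMap_ne_zero (b.coord i) (p := b i) (by simp)
  have h2 : ∀ i j, i ≠ j → b.coord i w ≠ 0 →
      ∀ᵐ x, b.coord i w * b.coord j x - b.coord j w * b.coord i x ≠ 0 := by
    intro i j hij hi
    have := ae_affineMap_ne_zero (b.coord i w • b.coord j - b.coord j w • b.coord i) (p := b j)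
      (by simpa [b.coord_apply, hij] using hi)
    simpa using this
  have h2' : ∀ᵐ x, ∀ i j, i ≠ j → b.coord i w ≠ 0 →
      b.coord i w * b.coord j x - b.coord j w * b.coord i x ≠ 0 := by
    simp only [ae_all_iff]
    exact h2
  filter_upwards [ae_all_iff.2 h1, h2'] with x hx1 hx2
  have hpos : ∃ i, 0 < b.coord i w := by
    by_contra! h
    have := Finset.sum_nonpos fun i (_ : i ∈ Finset.univ) => h i
    rw [b.sum_coord_apply_eq_one] at this
    linarith
  have := indicator_orthant_eq_sum_crossings (fun i => b.coord i w) (fun i => b.coord i x)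
    hpos hx1 hx2
  simp only [b.convexHull_eq_nonneg_coord, Set.mem_ofPred_eq]
  refine Eq.trans (by congr) (this.trans (Finset.sum_congr rfl fun i _ => ?_))
  by_cases hi : b.coord i w = 0
  · simp [hi]
  · congr 1
    by_cases hm : x ∈ convexHull ℝ (Set.range (Function.update b i w))
    · rw [if_pos hm, if_pos ((mem_convexHull_update_iff b w x hi).1 hm)]
    · rw [if_neg hm, if_neg fun h => hm ((mem_convexHull_update_iff b w x hi).2 h)]

theorem integrableOn_volDensity_convexHull {v : Fin 4 → E3} (hv : ∀ i, ‖v i‖ ≤ 1) :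
    IntegrableOn volDensity (convexHull ℝ (Set.range v)) := by
  rw [← tetrahedron_eq_convexHull_range]
  exact integrableOn_volDensity_tetrahedron hv

theorem measurableSet_convexHull_range (v : Fin 4 → E3) :
    MeasurableSet (convexHull ℝ (Set.range v)) := by
  rw [← tetrahedron_eq_convexHull_range]
  exact (isCompact_tetrahedron _ _ _ _).measurableSet

theorem norm_update_le {v : Fin 4 → E3} (hv : ∀ i, ‖v i‖ ≤ 1) {w : E3} (hw : ‖w‖ ≤ 1)
    (i j : Fin 4) : ‖Function.update v i w j‖ ≤ 1 := by
  by_cases h : j = i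
  · subst h
    simpa using hw
  · simpa [h] using hv j

theorem algvolFamily_eq_sum_of_orient_ne_zero {v : Fin 4 → E3} (hv : ∀ i, ‖v i‖ ≤ 1) {w : E3}
    (hw : ‖w‖ ≤ 1) (h0 : orient v ≠ 0) :
    algvolFamily v = ∑ i, algvolFamily (Function.update v i w) := by
  classical
  let b : AffineBasis (Fin 4) ℝ E3 :=
    ⟨v, affineIndependent_of_orient_ne_zero h0, affineSpan_eq_top_of_orient_ne_zero h0⟩
  have hb : ⇑b = v := rfl
  have hind : ∀ u : Fin 4 → E3, ∫ x in convexHull ℝ (Set.range u), volDensity x =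
      ∫ x, (if x ∈ convexHull ℝ (Set.range u) then 1 else 0) * volDensity x := by
    intro u
    rw [← integral_indicator (measurableSet_convexHull_range u)]
    congr 1
    ext x
    simp [Set.indicator_apply]
  have hint : ∀ u : Fin 4 → E3, (∀ i, ‖u i‖ ≤ 1) → Integrable fun x =>
      (if x ∈ convexHull ℝ (Set.range u) then 1 else 0) * volDensity x := by
    intro u hu
    have := (integrable_indicator_iff (measurableSet_convexHull_range u)).2
      (integrableOn_volDensity_convexHull hu)
    refine this.congr (ae_of_all _ fun x => ?_)
    simp [Set.indicator_apply]
  have hae := ae_indicator_tetrahedron_eq b w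
  rw [hb] at hae
  have hkey : ∫ x in convexHull ℝ (Set.range v), volDensity x =
      ∑ i, (SignType.sign (b.coord i w) : ℝ) *
        ∫ x in convexHull ℝ (Set.range (Function.update v i w)), volDensity x := by
    simp only [hind]
    simp only [← integral_const_mul]
    rw [← integral_finsetSum]
    · refine integral_congr_ae ?_
      filter_upwards [hae] with x hx
      rw [hx, Finset.sum_mul]
      exact Finset.sum_congr rfl fun i _ => by ring
    · intro i _
      exact (hint _ (norm_update_le hv hw i)).const_mul _
  rw [algvolFamily_eq, hkey, Finset.mul_sum]
  refine Finset.sum_congr rfl fun i _ => ?_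
  have ho := orient_update b w i
  rw [hb] at ho
  rw [algvolFamily_eq, ho, sign_mul]
  push_cast
  ring

/-- Additivity of the algebraic volume: coning off the boundary of a tetrahedron from a point `w`
does not change the volume. -/
theorem algvolFamily_eq_sum {v : Fin 4 → E3} (hv : ∀ i, ‖v i‖ ≤ 1) {w : E3} (hw : ‖w‖ ≤ 1) :
    algvolFamily v = ∑ i, algvolFamily (Function.update v i w) := by
  by_cases h0 : orient v ≠ 0
  · exact algvolFamily_eq_sum_of_orient_ne_zero hv hw h0
  by_cases h1 : ∃ i, orient (Function.update v i w) ≠ 0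
  · -- apply the nondegenerate case to the tetrahedron with `w` in place of `v i`, coned from `v i`
    obtain ⟨i, hi⟩ := h1
    have h := algvolFamily_eq_sum_of_orient_ne_zero (norm_update_le hv hw i) (hv i) hi
    rw [← Finset.add_sum_erase _ _ (Finset.mem_univ i)] at h ⊢
    have h2 : ∀ j ∈ Finset.univ.erase i,
        algvolFamily (Function.update (Function.update v i w) j (v i)) =
          -algvolFamily (Function.update v j w) := by
      intro j hj
      have hji := Finset.ne_of_mem_erase hj
      rw [← algvolFamily_comp_swap _ hji.symm]
      congr 1
      ext k : 1
      by_cases hkj : k = j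
      · subst hkj
        simp [hji.symm]
      · by_cases hki : k = i
        · subst hki
          simp [hji.symm]
        · simp [hkj, hki, Equiv.swap_apply_of_ne_of_ne hki hkj]
    rw [Finset.sum_congr rfl h2, Finset.sum_neg_distrib] at h
    simp only [Function.update_idem, Function.update_eq_self] at h
    linarith
  · push Not at h0 h1
    rw [algvolFamily_eq_zero h0, Finset.sum_eq_zero fun i _ => algvolFamily_eq_zero (h1 i)]

/-! ### Invariance under orientation preserving isometries -/

theorem projAct_apply (A : Matrix (Fin 4) (Fin 4) ℝ) (x : E3) (i : Fin 3) :
    projAct A x i = (A *ᵥ homog x) i.succ / (A *ᵥ homog x) 0 := rfl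

theorem homog_projAct (A : Matrix (Fin 4) (Fin 4) ℝ) (x : E3) (h : (A *ᵥ homog x) 0 ≠ 0) :
    homog (projAct A x) = ((A *ᵥ homog x) 0)⁻¹ • A *ᵥ homog x := by
  ext j
  refine Fin.cases ?_ (fun j => ?_) j
  · simp [homog_apply, h]
  · change projAct A x j = _
    rw [projAct_apply, div_eq_inv_mul]
    rfl

theorem homog_injective : Function.Injective homog := by
  intro x y h
  ext j
  exact congrFun h j.succ

theorem lorentzForm_mul_self : lorentzForm * lorentzForm = 1 := by
  rw [lorentzForm, Matrix.diagonal_mul_diagonal, ← Matrix.diagonal_one]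
  congr 1
  ext i
  fin_cases i <;> simp

/-- The transpose of a Lorentz matrix is a Lorentz matrix. -/
theorem mul_lorentzForm_mul_transpose {A : Matrix (Fin 4) (Fin 4) ℝ}
    (hA : Aᵀ * lorentzForm * A = lorentzForm) : A * lorentzForm * Aᵀ = lorentzForm := by
  have h1 : (lorentzForm * Aᵀ * lorentzForm) * A = 1 := by
    rw [Matrix.mul_assoc, Matrix.mul_assoc, ← Matrix.mul_assoc Aᵀ, hA, lorentzForm_mul_self]
  have h2 := mul_eq_one_comm.1 h1
  calc A * lorentzForm * Aᵀ = A * (lorentzForm * Aᵀ * lorentzForm) * lorentzForm := by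
        simp only [Matrix.mul_assoc, lorentzForm_mul_self, Matrix.mul_one]
    _ = lorentzForm := by rw [h2, Matrix.one_mul]

theorem mulVec_homog_apply (A : Matrix (Fin 4) (Fin 4) ℝ) (x : E3) (k : Fin 4) :
    (A *ᵥ homog x) k = A k 0 + ∑ j : Fin 3, A k j.succ * x j := by
  rw [Matrix.mulVec, dotProduct, Fin.sum_univ_succ]
  simp [homog]

/-- A Lorentz matrix maps the closed future cone to itself. -/
theorem mulVec_homog_zero_pos {A : Matrix (Fin 4) (Fin 4) ℝ} (hA : A ∈ IsomPlus) {x : E3}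
    (hx : ‖x‖ ≤ 1) : 0 < (A *ᵥ homog x) 0 := by
  obtain ⟨hA1, -, hA3⟩ := hA
  have h1 := congrFun (congrFun (mul_lorentzForm_mul_transpose hA1) 0) 0
  have h2 : A 0 0 ^ 2 = 1 + ∑ j : Fin 3, A 0 j.succ ^ 2 := by
    simp [lorentzForm, Matrix.mul_apply, Fin.sum_univ_succ, Matrix.diagonal_apply] at h1 ⊢
    linarith
  have h3 := Finset.sum_mul_sq_le_sq_mul_sq Finset.univ (fun j : Fin 3 => A 0 j.succ) x
  have h4 : ∑ j, x j ^ 2 ≤ 1 := by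
    rw [← EuclideanSpace.real_norm_sq_eq]
    exact pow_le_one₀ (norm_nonneg _) hx
  have h5 : 0 ≤ ∑ j : Fin 3, A 0 j.succ ^ 2 := Finset.sum_nonneg fun j _ => sq_nonneg _
  have h6 : |∑ j : Fin 3, A 0 j.succ * x j| < A 0 0 := by
    refine abs_lt_of_sq_lt_sq ?_ hA3.le
    nlinarith
  rw [mulVec_homog_apply]
  linarith [(abs_lt.1 h6).1]

theorem one_sub_norm_projAct_sq {A : Matrix (Fin 4) (Fin 4) ℝ} (hA : A ∈ IsomPlus) {x : E3}
    (hx : ‖x‖ ≤ 1) :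
    1 - ‖projAct A x‖ ^ 2 = (1 - ‖x‖ ^ 2) / (A *ᵥ homog x) 0 ^ 2 := by
  have hw := mulVec_homog_zero_pos hA hx
  have hq : ∀ u : Fin 4 → ℝ, u ⬝ᵥ lorentzForm *ᵥ u = -u 0 ^ 2 + ∑ j : Fin 3, u j.succ ^ 2 := by
    intro u
    simp [lorentzForm, dotProduct, Fin.sum_univ_succ, Matrix.mulVec_diagonal]
    ring
  have h1 : (A *ᵥ homog x) ⬝ᵥ lorentzForm *ᵥ (A *ᵥ homog x) =
      homog x ⬝ᵥ lorentzForm *ᵥ homog x := by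
    conv_rhs => rw [← hA.1, ← Matrix.mulVec_mulVec, ← Matrix.mulVec_mulVec,
      Matrix.dotProduct_mulVec _ Aᵀ, Matrix.vecMul_transpose]
  rw [hq, hq] at h1
  rw [EuclideanSpace.real_norm_sq_eq, EuclideanSpace.real_norm_sq_eq]
  simp only [projAct_apply, div_pow, ← Finset.sum_div]
  have h2 : ∀ j : Fin 3, homog x j.succ = x j := fun _ => rfl
  have h3 : homog x 0 = 1 := rfl
  simp only [h2, h3] at h1
  field_simp
  linarith

theorem norm_projAct_le {A : Matrix (Fin 4) (Fin 4) ℝ} (hA : A ∈ IsomPlus) {x : E3}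
    (hx : ‖x‖ ≤ 1) : ‖projAct A x‖ ≤ 1 := by
  have h := one_sub_norm_projAct_sq hA hx
  have h1 : 0 ≤ 1 - ‖x‖ ^ 2 := sub_nonneg.2 (pow_le_one₀ (norm_nonneg _) hx)
  have h2 : 0 ≤ 1 - ‖projAct A x‖ ^ 2 := h ▸ by positivity
  nlinarith [norm_nonneg (projAct A x)]

theorem norm_projAct_eq_one {A : Matrix (Fin 4) (Fin 4) ℝ} (hA : A ∈ IsomPlus) {x : E3}
    (hx : ‖x‖ = 1) : ‖projAct A x‖ = 1 := by
  have h := one_sub_norm_projAct_sq hA hx.le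
  rw [hx] at h
  have h2 : ‖projAct A x‖ ^ 2 = 1 := by
    simp at h
    linarith
  exact (pow_eq_one_iff_of_nonneg (norm_nonneg _) two_ne_zero).1 h2

theorem mulVec_injective_of_det_eq_one {A : Matrix (Fin 4) (Fin 4) ℝ} (hA : A.det = 1) :
    Function.Injective (A *ᵥ ·) :=
  Matrix.mulVec_injective_of_isUnit ((Matrix.isUnit_iff_isUnit_det A).2 (by simp [hA]))

theorem injOn_projAct {A : Matrix (Fin 4) (Fin 4) ℝ} (hA : A ∈ IsomPlus) :
    Set.InjOn (projAct A) (Metric.closedBall 0 1) := by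
  intro x hx y hy hxy
  rw [mem_closedBall_zero_iff] at hx hy
  have hwx := (mulVec_homog_zero_pos hA hx).ne'
  have hwy := (mulVec_homog_zero_pos hA hy).ne'
  have h : ((A *ᵥ homog x) 0)⁻¹ • homog x = ((A *ᵥ homog y) 0)⁻¹ • homog y := by
    apply mulVec_injective_of_det_eq_one hA.2.1
    simp only [Matrix.mulVec_smul]
    rw [← homog_projAct A x hwx, ← homog_projAct A y hwy, hxy]
  have h0 : ((A *ᵥ homog x) 0)⁻¹ = ((A *ᵥ homog y) 0)⁻¹ := by
    simpa [homog_apply] using congrFun h 0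
  rw [h0] at h
  exact homog_injective (smul_right_injective _ (inv_ne_zero hwy) h)

theorem orient_projAct {A : Matrix (Fin 4) (Fin 4) ℝ} (hA : A ∈ IsomPlus) {v : Fin 4 → E3}
    (hv : ∀ i, ‖v i‖ ≤ 1) :
    orient (fun i => projAct A (v i)) = (∏ i, ((A *ᵥ homog (v i)) 0)⁻¹) * orient v := by
  have : (Matrix.of fun i => homog (projAct A (v i))) =
      Matrix.diagonal (fun i => ((A *ᵥ homog (v i)) 0)⁻¹) *
        ((Matrix.of fun i => homog (v i)) * Aᵀ) := by
    ext i j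
    rw [Matrix.diagonal_mul, Matrix.of_apply,
      homog_projAct A _ (mulVec_homog_zero_pos hA (hv i)).ne', Pi.smul_apply, smul_eq_mul]
    congr 1
    simp [Matrix.mul_apply, Matrix.mulVec, dotProduct, mul_comm]
  rw [orient, this, Matrix.det_mul, Matrix.det_mul, Matrix.det_diagonal, Matrix.det_transpose,
    hA.2.1, mul_one, orient]

/-- A projective map sends a convex combination to the convex combination of the images with the
weights rescaled by the homogenizing factors. -/
theorem projAct_sum {A : Matrix (Fin 4) (Fin 4) ℝ} (v : Fin 4 → E3) (t : Fin 4 → ℝ)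
    (ht : ∑ i, t i = 1) (hw : ∀ i, (A *ᵥ homog (v i)) 0 ≠ 0) :
    projAct A (∑ i, t i • v i) = ∑ i, (t i * (A *ᵥ homog (v i)) 0 /
      ∑ j, t j * (A *ᵥ homog (v j)) 0) • projAct A (v i) := by
  have h : A *ᵥ homog (∑ i, t i • v i) = ∑ i, t i • A *ᵥ homog (v i) := by
    rw [homog_sum _ _ _ ht, Matrix.mulVec_sum]
    simp only [Matrix.mulVec_smul]
  ext k
  rw [projAct_apply, h]
  simp only [Finset.sum_apply, Pi.smul_apply, smul_eq_mul, WithLp.ofLp_sum, WithLp.ofLp_smul, projAct_apply, Finset.sum_div]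
  refine Finset.sum_congr rfl fun i _ => ?_
  have := hw i
  field_simp

/-- Projective maps carry geodesic tetrahedra to geodesic tetrahedra. -/
theorem image_projAct_convexHull {A : Matrix (Fin 4) (Fin 4) ℝ} (hA : A ∈ IsomPlus)
    {v : Fin 4 → E3} (hv : ∀ i, ‖v i‖ ≤ 1) :
    projAct A '' convexHull ℝ (Set.range v) =
      convexHull ℝ (Set.range fun i => projAct A (v i)) := by
  have hw : ∀ i, 0 < (A *ᵥ homog (v i)) 0 := fun i => mulVec_homog_zero_pos hA (hv i)
  have hpos : ∀ t : Fin 4 → ℝ, (∀ i, 0 ≤ t i) → ∑ i, t i = 1 → ∀ c : Fin 4 → ℝ, (∀ i, 0 < c i) →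
      0 < ∑ i, t i * c i := by
    intro t ht ht1 c hc
    refine Finset.sum_pos' (fun i _ => mul_nonneg (ht i) (hc i).le) ?_
    by_contra! h
    have : ∑ i, t i ≤ 0 := Finset.sum_nonpos fun i _ => by
      by_contra! h'
      exact (mul_pos h' (hc i)).not_ge (h i (Finset.mem_univ i))
    linarith
  rw [← tetrahedron_eq_convexHull_range, ← tetrahedron_eq_convexHull_range]
  apply Set.Subset.antisymm
  · rintro _ ⟨x, hx, rfl⟩
    obtain ⟨t, ht, ht1, rfl⟩ := (mem_tetrahedron_iff v x).1 hx
    have hN := hpos t ht ht1 _ hw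
    refine (mem_tetrahedron_iff (fun i => projAct A (v i)) _).2 ⟨_, fun i => ?_, ?_,
      (projAct_sum v t ht1 fun i => (hw i).ne').symm⟩
    · exact div_nonneg (mul_nonneg (ht i) (hw i).le) hN.le
    · rw [← Finset.sum_div, div_self hN.ne']
  · intro y hy
    obtain ⟨s, hs, hs1, rfl⟩ := (mem_tetrahedron_iff (fun i => projAct A (v i)) y).1 hy
    have hN := hpos s hs hs1 _ fun i => inv_pos.2 (hw i)
    set N := ∑ i, s i * ((A *ᵥ homog (v i)) 0)⁻¹ with hNdef
    have ht1 : ∑ i, s i * ((A *ᵥ homog (v i)) 0)⁻¹ / N = 1 := by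
      rw [← Finset.sum_div, div_self hN.ne']
    refine ⟨∑ i, (s i * ((A *ᵥ homog (v i)) 0)⁻¹ / N) • v i,
      (mem_tetrahedron_iff v _).2 ⟨_, fun i => ?_, ht1, rfl⟩, ?_⟩
    · exact div_nonneg (mul_nonneg (hs i) (inv_nonneg.2 (hw i).le)) hN.le
    · have h1 : ∀ i, s i * ((A *ᵥ homog (v i)) 0)⁻¹ / N * (A *ᵥ homog (v i)) 0 = s i / N := by
        intro i
        have := (hw i).ne'
        field_simp
      rw [projAct_sum v _ ht1 fun i => (hw i).ne']
      refine Finset.sum_congr rfl fun i _ => ?_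
      simp only [h1, ← Finset.sum_div, hs1]
      congr 1
      field_simp

/-- The Jacobian matrix of the projective action. -/
noncomputable def jacobian (A : Matrix (Fin 4) (Fin 4) ℝ) (x : E3) : Matrix (Fin 3) (Fin 3) ℝ :=
  Matrix.of fun i j => (A i.succ j.succ * (A *ᵥ homog x) 0 - (A *ᵥ homog x) i.succ * A 0 j.succ) /
    (A *ᵥ homog x) 0 ^ 2

theorem hasFDerivAt_projAct (A : Matrix (Fin 4) (Fin 4) ℝ) {x : E3}
    (hx : (A *ᵥ homog x) 0 ≠ 0) :
    HasFDerivAt (projAct A)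
      (LinearMap.toContinuousLinearMap ((jacobian A x).toLpLin 2 2)) x := by
  rw [← hasFDerivWithinAt_univ, hasFDerivWithinAt_euclidean]
  intro i
  have hlin : ∀ k, HasFDerivAt (fun y : E3 => (A *ᵥ homog y) k)
      (∑ j : Fin 3, A k j.succ • (EuclideanSpace.proj j : E3 →L[ℝ] ℝ)) x := by
    intro k
    simp only [mulVec_homog_apply]
    refine HasFDerivAt.const_add _ (HasFDerivAt.fun_sum fun j _ => ?_)
    exact ((EuclideanSpace.proj j : E3 →L[ℝ] ℝ).hasFDerivAt).const_mul _
  have h := (hlin i.succ).mul ((hasDerivAt_inv hx).comp_hasFDerivAt x (hlin 0))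
  have hfun : (fun y => projAct A y i) =
      (fun y => (A *ᵥ homog y) i.succ) * ((fun r => r⁻¹) ∘ fun y => (A *ᵥ homog y) 0) := by
    funext y
    simp [projAct_apply, div_eq_mul_inv]
  rw [hfun]
  refine (h.congr_fderiv ?_).hasFDerivWithinAt
  ext y
  change _ = (jacobian A x *ᵥ y.ofLp) i
  simp only [jacobian, Function.comp_apply]
  generalize A *ᵥ homog x = u at hx
  simp [Matrix.mulVec, dotProduct, Fin.sum_univ_three]
  field_simp
  ring

theorem det_jacobian (A : Matrix (Fin 4) (Fin 4) ℝ) {x : E3} (hx : (A *ᵥ homog x) 0 ≠ 0) :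
    (jacobian A x).det = A.det / (A *ᵥ homog x) 0 ^ 4 := by
  have h := fun k => mulVec_homog_apply A x k
  simp only [Fin.sum_univ_three] at h
  have hk : ∀ k, A k 0 = (A *ᵥ homog x) k -
      (A k 1 * x 0 + A k 2 * x 1 + A k 3 * x 2) := by
    intro k
    rw [h k]
    simp
  rw [Matrix.det_succ_row_zero A, Matrix.det_fin_three]
  simp [Fin.sum_univ_succ, Matrix.det_fin_three, Fin.succAbove, jacobian]
  -- write the first column of `A` in terms of `A (1, x)` and the other columns
  rw [hk 0, hk 1, hk 2, hk 3]
  field_simp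
  ring

theorem integral_volDensity_projAct {A : Matrix (Fin 4) (Fin 4) ℝ} (hA : A ∈ IsomPlus)
    {v : Fin 4 → E3} (hv : ∀ i, ‖v i‖ ≤ 1) :
    ∫ x in convexHull ℝ (Set.range fun i => projAct A (v i)), volDensity x =
      ∫ x in convexHull ℝ (Set.range v), volDensity x := by
  have hsub : convexHull ℝ (Set.range v) ⊆ Metric.closedBall 0 1 := by
    rw [← tetrahedron_eq_convexHull_range]
    exact tetrahedron_subset_closedBall hv
  have hw : ∀ x ∈ convexHull ℝ (Set.range v), 0 < (A *ᵥ homog x) 0 := fun x hx =>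
    mulVec_homog_zero_pos hA (mem_closedBall_zero_iff.1 (hsub hx))
  rw [← image_projAct_convexHull hA hv,
    integral_image_eq_integral_abs_det_fderiv_smul volume (measurableSet_convexHull_range v)
      (fun x hx => (hasFDerivAt_projAct A (hw x hx).ne').hasFDerivWithinAt)
      ((injOn_projAct hA).mono hsub)]
  refine setIntegral_congr_fun (measurableSet_convexHull_range v) fun x hx => ?_
  have h1 := hw x hx
  have h2 : (LinearMap.toContinuousLinearMap ((jacobian A x).toLpLin 2 2)).det =
      ((A *ᵥ homog x) 0 ^ 4)⁻¹ := by
    rw [LinearMap.det_toContinuousLinearMap, LinearMap.det_toLpLin, det_jacobian A h1.ne',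
      hA.2.1, one_div]
  simp only [h2, smul_eq_mul, volDensity]
  rw [one_sub_norm_projAct_sq hA (mem_closedBall_zero_iff.1 (hsub hx)),
    abs_of_pos (by positivity), ← mul_inv]
  congr 1
  field_simp

theorem algvol_projAct {A : Matrix (Fin 4) (Fin 4) ℝ} (hA : A ∈ IsomPlus) {v₀ v₁ v₂ v₃ : E3}
    (h₀ : ‖v₀‖ ≤ 1) (h₁ : ‖v₁‖ ≤ 1) (h₂ : ‖v₂‖ ≤ 1) (h₃ : ‖v₃‖ ≤ 1) :
    algvol (projAct A v₀) (projAct A v₁) (projAct A v₂) (projAct A v₃) = algvol v₀ v₁ v₂ v₃ := by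
  have hv : ∀ i, ‖(![v₀, v₁, v₂, v₃] : Fin 4 → E3) i‖ ≤ 1 := by
    intro i
    fin_cases i <;> assumption
  have h1 := algvolFamily_eq fun i => projAct A (![v₀, v₁, v₂, v₃] i)
  have h2 := algvolFamily_eq ![v₀, v₁, v₂, v₃]
  rw [integral_volDensity_projAct hA hv, orient_projAct hA hv, sign_mul,
    sign_pos (Finset.prod_pos fun i _ => inv_pos.2 (mulVec_homog_zero_pos hA (hv i))), one_mul,
    ← h2] at h1
  exact h1

theorem continuousOn_projAct {A : Matrix (Fin 4) (Fin 4) ℝ} (hA : A ∈ IsomPlus) :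
    ContinuousOn (projAct A) (Metric.closedBall 0 1) := fun _ hx =>
  (hasFDerivAt_projAct A (mulVec_homog_zero_pos hA
    (mem_closedBall_zero_iff.1 hx)).ne').continuousAt.continuousWithinAt

/-- An identity between products of isometries of the open ball persists on the sphere. -/
theorem projAct_projAct_eq_of_ball {A B C D : Matrix (Fin 4) (Fin 4) ℝ} (hA : A ∈ IsomPlus)
    (hB : B ∈ IsomPlus) (hC : C ∈ IsomPlus) (hD : D ∈ IsomPlus)
    (h : ∀ b : H3, projAct A (projAct B b) = projAct C (projAct D b)) {x : E3} (hx : ‖x‖ ≤ 1) :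
    projAct A (projAct B x) = projAct C (projAct D x) := by
  have hcomp : ∀ {A B : Matrix (Fin 4) (Fin 4) ℝ}, A ∈ IsomPlus → B ∈ IsomPlus →
      ContinuousOn (fun y => projAct A (projAct B y)) (Metric.closedBall 0 1) := by
    intro A B hA hB
    refine (continuousOn_projAct hA).comp (continuousOn_projAct hB) fun y hy => ?_
    rw [mem_closedBall_zero_iff] at hy ⊢
    exact norm_projAct_le hB hy
  have heq : Set.EqOn (fun y => projAct A (projAct B y)) (fun y => projAct C (projAct D y))
      (Metric.ball 0 1) := fun y hy => h ⟨y, hy⟩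
  exact heq.of_subset_closure (hcomp hA hB) (hcomp hC hD) Metric.ball_subset_closedBall
    (by rw [closure_ball _ one_ne_zero]) (mem_closedBall_zero_iff.2 hx)

/-! ### Relations for the algebraic volume -/

theorem algvol_swap_zero_one (a b c d : E3) : algvol b a c d = -algvol a b c d :=
  algvolFamily_comp_swap ![a, b, c, d] (i := 0) (j := 1) (by decide)

theorem algvol_swap_one_two (a b c d : E3) : algvol a c b d = -algvol a b c d :=
  algvolFamily_comp_swap ![a, b, c, d] (i := 1) (j := 2) (by decide)

theorem algvol_swap_two_three (a b c d : E3) : algvol a b d c = -algvol a b c d :=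
  algvolFamily_comp_swap ![a, b, c, d] (i := 2) (j := 3) (by decide)

theorem algvol_self_two_three (a b c : E3) : algvol a b c c = 0 := by
  have := algvol_swap_two_three a b c c
  linarith

/-- The five-term relation: the algebraic volume is a cocycle on the simplices with vertices in the
closed ball. -/
theorem algvol_five_term {a b c d e : E3} (ha : ‖a‖ ≤ 1) (hb : ‖b‖ ≤ 1) (hc : ‖c‖ ≤ 1)
    (hd : ‖d‖ ≤ 1) (he : ‖e‖ ≤ 1) :
    algvol b c d e - algvol a c d e + algvol a b d e - algvol a b c e + algvol a b c d = 0 := by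
  have hv : ∀ i, ‖(![a, b, c, d] : Fin 4 → E3) i‖ ≤ 1 := by
    intro i
    fin_cases i <;> assumption
  have h := algvolFamily_eq_sum hv he
  rw [Fin.sum_univ_four] at h
  change algvol a b c d = algvol e b c d + algvol a e c d + algvol a b e d + algvol a b c e at h
  have h1 := algvol_swap_two_three a b d e
  have h2 := algvol_swap_one_two a c e d
  have h3 := algvol_swap_two_three a c d e
  have h4 := algvol_swap_zero_one b e c d
  have h5 := algvol_swap_one_two b c e d
  have h6 := algvol_swap_two_three b c d e
  linarith

/-! ### The action of the associated group -/

theorem rdot_rdot_qstar {Q Y : Type*} [Quandle Q] [MulAction (Rack.EnvelGroup Q) Y] (r : Y)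
    (x y : Q) : rdot (rdot r y) (qstar x y) = rdot (rdot r x) y := by
  have h : (Rack.toEnvelGroup Q (Shelf.act y x) : Rack.EnvelGroup Q) =
      (Rack.toEnvelGroup Q y : Rack.EnvelGroup Q) * (Rack.toEnvelGroup Q x : Rack.EnvelGroup Q) *
        (Rack.toEnvelGroup Q y : Rack.EnvelGroup Q)⁻¹ :=
    (Rack.toEnvelGroup Q).map_act
  rw [rdot, rdot, rdot, rdot, qstar, h, mul_smul, mul_smul, inv_smul_smul]

theorem qstar_qstar_qstar {Q : Type*} [Quandle Q] (x y z : Q) :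
    qstar (qstar x z) (qstar y z) = qstar (qstar x y) z :=
  (Shelf.self_distrib (x := z) (y := y) (z := x)).symm

theorem qstar_self {Q : Type*} [Quandle Q] (x : Q) : qstar x x = x := Quandle.fix

namespace HyperbolicCovering

open OrientedKnot

variable {K : OrientedKnot} (Ψ : HyperbolicCovering K) {p q : K.Complement} (pt : Ψ.proj ⁻¹' {p})

/-! ### Lifts and holonomy -/

theorem holonomy_mem (g : FundamentalGroup K.Complement p) : Ψ.holonomy pt g ∈ IsomPlus :=
  (Ψ.exists_holonomy pt g).choose_spec.1

theorem exists_deck (g : FundamentalGroup K.Complement p) :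
    ∃ h : H3 ≃ₜ H3, (∀ b, Ψ.proj (h b) = Ψ.proj b) ∧
      h pt.1 = Ψ.liftEnd pt (FundamentalGroup.toPath g) ∧
      ∀ b : H3, (h b : E3) = projAct (Ψ.holonomy pt g) b :=
  (Ψ.exists_holonomy pt g).choose_spec.2

/-- Deck transformations commute with path lifting. -/
theorem monodromy_deck {h : H3 ≃ₜ H3} (hh : ∀ b, Ψ.proj (h b) = Ψ.proj b)
    (r : Path.Homotopic.Quotient p q) (e e' : Ψ.proj ⁻¹' {p}) (he : h e.1 = e'.1) :
    (Ψ.isCoveringMap_proj.monodromy r e').1 = h (Ψ.isCoveringMap_proj.monodromy r e).1 := by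
  obtain ⟨γ, rfl⟩ := Path.Homotopic.Quotient.mk_surjective r
  have cov := Ψ.isCoveringMap_proj
  have h0 : ∀ e : Ψ.proj ⁻¹' {p}, γ 0 = Ψ.proj e.1 := fun e => γ.source.trans e.2.symm
  have key : (⟨h, h.continuous⟩ : C(H3, H3)).comp (cov.liftPath γ e.1 (h0 e)) =
      cov.liftPath γ e'.1 (h0 e') := by
    refine (cov.eq_liftPath_iff' (h0 e')).2 ⟨?_, ?_⟩
    · funext s
      exact (hh _).trans (congrFun (cov.liftPath_lifts γ e.1 (h0 e)) s)
    · exact (congrArg h (cov.liftPath_zero γ e.1 (h0 e))).trans he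
  exact (congrArg (fun f : C(I, H3) => f 1) key).symm

theorem monodromy_trans_deck {g : FundamentalGroup K.Complement p} {h : H3 ≃ₜ H3}
    (hh : ∀ b, Ψ.proj (h b) = Ψ.proj b)
    (hg : h pt.1 = Ψ.liftEnd pt (FundamentalGroup.toPath g)) (r : Path.Homotopic.Quotient p q) :
    (Ψ.isCoveringMap_proj.monodromy ((FundamentalGroup.toPath g).trans r) pt).1 =
      h (Ψ.isCoveringMap_proj.monodromy r pt).1 := by
  rw [Ψ.isCoveringMap_proj.monodromy_trans_apply]
  exact Ψ.monodromy_deck hh r pt _ hg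

/-- The lift of `r · x = x⁻¹ r` ends at `ρ(x)⁻¹` applied to the end point of the lift of `r`. -/
theorem projAct_holonomy_liftEnd_rdot (r : PathClass p q) (x : KnotQuandle p) :
    projAct (Ψ.holonomy pt x.1) (Ψ.liftEnd pt (rdot r x)) = Ψ.liftEnd pt r := by
  obtain ⟨h, hh, hg, hA⟩ := Ψ.exists_deck pt x.1
  have h1 := Ψ.monodromy_trans_deck pt hh hg
    ((FundamentalGroup.toPath x.1).symm.trans (r : Path.Homotopic.Quotient p q))
  have h2 : ∀ (γ : Path.Homotopic.Quotient p p) (s : Path.Homotopic.Quotient p q),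
      γ.trans (γ.symm.trans s) = s := fun γ s => by
    rw [← Path.Homotopic.Quotient.trans_assoc, Path.Homotopic.Quotient.trans_symm,
      Path.Homotopic.Quotient.refl_trans]
  have h3 := congrArg (fun s => (Ψ.isCoveringMap_proj.monodromy s pt).1)
    (h2 (FundamentalGroup.toPath x.1) r)
  rw [← hA]
  exact congrArg Subtype.val (h1.symm.trans h3)

/-- The relation `ρ(y) ρ(x ∗ y) = ρ(x) ρ(y)`, on the closed ball. -/
theorem projAct_holonomy_qstar (x y : KnotQuandle p) {ξ : E3} (hξ : ‖ξ‖ ≤ 1) :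
    projAct (Ψ.holonomy pt y.1) (projAct (Ψ.holonomy pt (qstar x y).1) ξ) =
      projAct (Ψ.holonomy pt x.1) (projAct (Ψ.holonomy pt y.1) ξ) := by
  refine projAct_projAct_eq_of_ball (Ψ.holonomy_mem pt _) (Ψ.holonomy_mem pt _)
    (Ψ.holonomy_mem pt _) (Ψ.holonomy_mem pt _) (fun b => ?_) hξ
  obtain ⟨hx, hx1, hx2, hx3⟩ := Ψ.exists_deck pt x.1
  obtain ⟨hy, hy1, hy2, hy3⟩ := Ψ.exists_deck pt y.1
  obtain ⟨hz, hz1, hz2, hz3⟩ := Ψ.exists_deck pt (qstar x y).1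
  have hmul : (FundamentalGroup.toPath y.1).trans (FundamentalGroup.toPath (qstar x y).1) =
      (FundamentalGroup.toPath x.1).trans (FundamentalGroup.toPath y.1) := by
    have h : (qstar x y).1 * y.1 = y.1 * x.1 := by
      change y.1 * x.1 * y.1⁻¹ * y.1 = y.1 * x.1
      group
    exact h
  -- two deck transformations that agree at one point are equal
  have heq : hy ∘ hz = hx ∘ hy := by
    have : PreconnectedSpace H3 :=
      isPreconnected_iff_preconnectedSpace.1 (convex_ball (0 : E3) 1).isPreconnected
    refine Ψ.isCoveringMap_proj.eq_of_comp_eq (hy.continuous.comp hz.continuous)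
      (hx.continuous.comp hy.continuous) ?_ pt.1 ?_
    · funext b
      simp [hx1, hy1, hz1]
    · change hy (hz pt.1) = hx (hy pt.1)
      have e1 := Ψ.monodromy_trans_deck pt hy1 hy2 (FundamentalGroup.toPath (qstar x y).1)
      have e2 := Ψ.monodromy_trans_deck pt hx1 hx2 (FundamentalGroup.toPath y.1)
      rw [hmul, e2] at e1
      rw [hz2, hy2]
      exact e1.symm
  rw [← hz3, ← hy3, ← hy3, ← hx3]
  exact congrArg Subtype.val (congrFun heq b)

/-- The holonomy of every positive meridian has exactly one fixed point at infinity. -/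
def HasIdealPoints : Prop :=
  ∃ f : KnotQuandle p → SphereAtInfinity, ∀ (x : KnotQuandle p) (ξ : SphereAtInfinity),
    projAct (Ψ.holonomy pt x.1) ξ = (ξ : E3) ↔ ξ = f x

variable {pt}

theorem projAct_eq_self_iff (hf : Ψ.HasIdealPoints pt) (x : KnotQuandle p) (ξ : SphereAtInfinity) :
    projAct (Ψ.holonomy pt x.1) ξ = (ξ : E3) ↔ ξ = Ψ.idealPoint pt x := by
  have h : Ψ.idealPoint pt = hf.choose := dif_pos hf
  rw [h]
  exact hf.choose_spec x ξ

theorem projAct_idealPoint_self (hf : Ψ.HasIdealPoints pt) (x : KnotQuandle p) :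
    projAct (Ψ.holonomy pt x.1) (Ψ.idealPoint pt x) = Ψ.idealPoint pt x :=
  (Ψ.projAct_eq_self_iff hf x _).2 rfl

/-- Equivariance of the ideal points: `(x ∗ y)_∞ = ρ(y)⁻¹ x_∞`. -/
theorem projAct_idealPoint_qstar (hf : Ψ.HasIdealPoints pt) (x y : KnotQuandle p) :
    projAct (Ψ.holonomy pt y.1) (Ψ.idealPoint pt (qstar x y)) = Ψ.idealPoint pt x := by
  have hn : ‖(Ψ.idealPoint pt (qstar x y) : E3)‖ = 1 := norm_eq_of_mem_sphere _
  -- by `ρ(y) ρ(x ∗ y) = ρ(x) ρ(y)`, this point is fixed by `ρ(x)`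
  let η : SphereAtInfinity := ⟨projAct (Ψ.holonomy pt y.1) (Ψ.idealPoint pt (qstar x y)),
    mem_sphere_zero_iff_norm.2 (norm_projAct_eq_one (Ψ.holonomy_mem pt _) hn)⟩
  have h : η = Ψ.idealPoint pt x := by
    rw [← Ψ.projAct_eq_self_iff hf]
    change projAct _ (projAct _ _) = projAct _ _
    rw [← Ψ.projAct_holonomy_qstar pt x y hn.le, Ψ.projAct_idealPoint_self hf]
  exact congrArg Subtype.val h

theorem norm_liftEnd_le (r : PathClass p q) : ‖(Ψ.liftEnd pt r : E3)‖ ≤ 1 :=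
  (mem_ball_zero_iff.1 (Ψ.liftEnd pt r).2).le

theorem norm_idealPoint_le (x : KnotQuandle p) : ‖(Ψ.idealPoint pt x : E3)‖ ≤ 1 :=
  (norm_eq_of_mem_sphere _).le

/-- Translating a simplex by `ρ(z)⁻¹`. -/
theorem algvol_rdot_qstar (hf : Ψ.HasIdealPoints pt) (r : PathClass p q) (x y z : KnotQuandle p) :
    algvol (Ψ.liftEnd pt (rdot r z)) (Ψ.idealPoint pt (qstar x z)) (Ψ.idealPoint pt (qstar y z))
        (Ψ.idealPoint pt z) =
      algvol (Ψ.liftEnd pt r) (Ψ.idealPoint pt x) (Ψ.idealPoint pt y) (Ψ.idealPoint pt z) := by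
  rw [← algvol_projAct (Ψ.holonomy_mem pt z.1) (Ψ.norm_liftEnd_le _) (Ψ.norm_idealPoint_le _)
    (Ψ.norm_idealPoint_le _) (Ψ.norm_idealPoint_le _), Ψ.projAct_holonomy_liftEnd_rdot,
    Ψ.projAct_idealPoint_qstar hf, Ψ.projAct_idealPoint_qstar hf, Ψ.projAct_idealPoint_self hf]

/-- Without ideal points of the meridians, `idealPoint` is constant and all simplices are
degenerate. -/
theorem vol_eq_zero_of_not_hasIdealPoints (hf : ¬ Ψ.HasIdealPoints pt) (r : PathClass p q)
    (x y : KnotQuandle p) : Ψ.vol pt r x y = 0 := by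
  have h : Ψ.idealPoint pt = fun _ => ⟨EuclideanSpace.single 0 1, by simp⟩ := dif_neg hf
  simp only [vol, h, algvol_self_two_three, add_zero]

theorem vol_self (r : PathClass p q) (x : KnotQuandle p) : Ψ.vol pt r x x = 0 := by
  simp only [vol, qstar_self, algvol_self_two_three, add_zero]

theorem vol_cocycle (hf : Ψ.HasIdealPoints pt) (r : PathClass p q) (x y z : KnotQuandle p) :
    Ψ.vol pt r x y + Ψ.vol pt (rdot r y) (qstar x y) z + Ψ.vol pt r y z =
      Ψ.vol pt (rdot r x) y z + Ψ.vol pt r x z +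
        Ψ.vol pt (rdot r z) (qstar x z) (qstar y z) := by
  -- `δ r x y z` compares the three simplices at `r` with a simplex that does not involve `r`, and
  -- a simplex that does not involve the base point and hence is equivariant
  have δ : ∀ (r : PathClass p q) (x y z : KnotQuandle p),
      algvol pt.1 (Ψ.liftEnd pt r) (Ψ.idealPoint pt x) (Ψ.idealPoint pt y) -
        algvol pt.1 (Ψ.liftEnd pt r) (Ψ.idealPoint pt x) (Ψ.idealPoint pt z) +
        algvol pt.1 (Ψ.liftEnd pt r) (Ψ.idealPoint pt y) (Ψ.idealPoint pt z) =
      algvol pt.1 (Ψ.idealPoint pt x) (Ψ.idealPoint pt y) (Ψ.idealPoint pt z) -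
        algvol (Ψ.liftEnd pt r) (Ψ.idealPoint pt x) (Ψ.idealPoint pt y) (Ψ.idealPoint pt z) := by
    intro r x y z
    linarith [algvol_five_term (mem_ball_zero_iff.1 pt.1.2).le (Ψ.norm_liftEnd_le (pt := pt) r)
      (Ψ.norm_idealPoint_le (pt := pt) x) (Ψ.norm_idealPoint_le (pt := pt) y)
      (Ψ.norm_idealPoint_le (pt := pt) z)]
  have hvol : ∀ (r : PathClass p q) (x y : KnotQuandle p), Ψ.vol pt r x y =
      algvol pt.1 (Ψ.liftEnd pt r) (Ψ.idealPoint pt x) (Ψ.idealPoint pt y) -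
        algvol pt.1 (Ψ.liftEnd pt (rdot r x)) (Ψ.idealPoint pt x) (Ψ.idealPoint pt y) +
        algvol pt.1 (Ψ.liftEnd pt (rdot (rdot r x) y)) (Ψ.idealPoint pt (qstar x y))
          (Ψ.idealPoint pt y) -
        algvol pt.1 (Ψ.liftEnd pt (rdot r y)) (Ψ.idealPoint pt (qstar x y))
          (Ψ.idealPoint pt y) := by
    intro r x y
    rw [vol, algvol_swap_two_three _ _ (Ψ.idealPoint pt x : E3),
      algvol_swap_two_three _ _ (Ψ.idealPoint pt (qstar x y) : E3)]
    ring
  simp only [hvol, rdot_rdot_qstar, qstar_qstar_qstar]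
  have hxyz := δ (rdot (rdot (rdot r x) y) z) (qstar (qstar x y) z) (qstar y z) z
  have hyz := δ (rdot (rdot r y) z) (qstar (qstar x y) z) (qstar y z) z
  have e1 := Ψ.algvol_rdot_qstar hf r x y z
  have e2 := Ψ.algvol_rdot_qstar hf (rdot r x) x y z
  have e3 := Ψ.algvol_rdot_qstar hf (rdot r y) (qstar x y) y z
  have e4 := Ψ.algvol_rdot_qstar hf (rdot (rdot r x) y) (qstar x y) y z
  linarith [δ r x y z, δ (rdot r x) x y z, δ (rdot r y) (qstar x y) y z,
    δ (rdot (rdot r x) y) (qstar x y) y z, δ (rdot r z) (qstar x z) (qstar y z) z,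
    δ (rdot (rdot r x) z) (qstar x z) (qstar y z) z]

end HyperbolicCovering

end KnotVolume

theorem proposition3p1 (K : KnotVolume.OrientedKnot) (Ψ : KnotVolume.HyperbolicCovering K)
    (p q : K.Complement) (hqp : q ≠ p) (pt : Ψ.proj ⁻¹' {p}) :
    (∀ (r : KnotVolume.OrientedKnot.PathClass p q)
      (x y : KnotVolume.OrientedKnot.KnotQuandle p),
      MeasureTheory.IntegrableOn KnotVolume.volDensity
        (KnotVolume.tetrahedron pt.1 (Ψ.liftEnd pt r) (Ψ.idealPoint pt x) (Ψ.idealPoint pt y))) ∧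
    KnotVolume.IsQuandleTwoCocycle
      (fun (r : KnotVolume.OrientedKnot.PathClass p q)
        (x y : KnotVolume.OrientedKnot.KnotQuandle p) => Ψ.vol pt r x y) := by
  refine ⟨fun r x y => ?_, ⟨Ψ.vol_self, fun r x y z => ?_⟩⟩
  · refine KnotVolume.integrableOn_volDensity_tetrahedron
      (v := ![pt.1, Ψ.liftEnd pt r, Ψ.idealPoint pt x, Ψ.idealPoint pt y]) fun i => ?_
    fin_cases i
    exacts [(mem_ball_zero_iff.1 pt.1.2).le, Ψ.norm_liftEnd_le r, Ψ.norm_idealPoint_le x,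
      Ψ.norm_idealPoint_le y]
  · by_cases hf : Ψ.HasIdealPoints pt
    · exact Ψ.vol_cocycle hf r x y z
    · simp only [Ψ.vol_eq_zero_of_not_hasIdealPoints hf, add_zero]
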